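/- All vector spaces are over $\mathbb R$; arities are finite sets. \emph{Graphs.} $\mathsf{Gra}(V)$ is spanned by undirected graphs on the finite vertex set $V$ without tadpoles, with edges of degree $-1$ (an ordering of the edges is part of the data, up to sign; so there are no multiple edges). $\mathsf{Gra}_1(V)$ is spanned by directed graphs without tadpoles on $\{\mathit{in},\mathit{out}\}\sqcup V$, with edges of degree $-1$, where no edge starts at $\mathit{in}$ or ends at $\mathit{out}$. Operadic insertion $\Gamma\circ_v\gamma$ of $\gamma\in\mathsf{Gra}(B)$ at $v\in V$ reconnects the edges at $v$ to the vertices of $\gamma$ in all possible ways, where in $\mathsf{Gra}_1$ an undirected edge of $\gamma$ stands for the sum of its two orientations. The moperadic composition $\Gamma\circ\Gamma'$ in $\mathsf{Gra}_1$ deletes the vertex $\mathit{in}$ of $\Gamma$ and $\mathit{out}$ of $\Gamma'$; it reconnects, in all possible ways, the edges of $\Gamma$ ending at $\mathit{in}$ to $\mathit{in}$ or the numbered vertices of $\Gamma'$, and the edges of $\Gamma'$ starting at $\mathit{out}$ to $\mathit{out}$ or the numbered vertices of $\Gamma$. This makes $\mathsf{Gra}_1$ a moperad over the operad $\mathsf{Gra}$;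 its unit is the graph in $\mathsf{Gra}_1(\emptyset)$ without edges. \emph{Twists.} $\mathsf{fGraphs}(B)=\prod_{k\ge0}\bigl(\mathsf{Gra}(B\sqcup\{1,\dots,k\})\otimes\mathbb R[-2]^{\otimes k}\bigr)^{S_k}$, and $\mathsf{fGraphs}_1(A)=\prod_{k\ge0}\bigl(\mathsf{Gra}_1(A\sqcup\{1,\dots,k\})\otimes\mathbb R[-2]^{\otimes k}\bigr)^{S_k}$ (products of graded spaces): possibly infinite linear combinations of graphs with external vertices labelled by $A$ and $k$ indistinguishable internal vertices $\bullet$ of degree $2$. A graph with $k$ internal vertices and $e$ edges has degree $2k-e$. The insertions at external vertices and the moperadic composition are induced from $\mathsf{Gra}$ and $\mathsf{Gra}_1$, summing over the distributions of the labels of internal vertices. The differential is $$\delta\Gamma=m\circ\Gamma-(-1)^{|\Gamma|}\Bigl(\Gamma\circ m+\sum_{a}\Gamma\circ_a b+\tfrac12\sum_{i}\Gamma\circ_i b\Bigr),$$ symmetrized over the label of the new internal vertex. Here $m$ is the graph with one numbered vertex, which becomes internal, and the edge $\bullet\to\mathit{in}$, minus the one with the edge $\mathit{out}\to\bullet$;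 $b\in\mathsf{Gra}(2)$ is the graph with one edge; $a$ runs over the external and $i$ over the internal vertices; and in $\Gamma\circ_a b$, $\Gamma\circ_i b$ one vertex of $b$ replaces $a$ or $i$ and the other is the new internal vertex. \emph{Subspaces.} $\mathsf{Graphs}(B)\subset\mathsf{fGraphs}(B)$ consists of the possibly infinite linear combinations of graphs whose internal vertices are all at least trivalent and that have no connected component with internal vertices only. $\mathsf{Graphs}_1(A)\subset\mathsf{fGraphs}_1(A)$ consists of the possibly infinite linear combinations of graphs $\Gamma$ such that 1. all internal vertices of $\Gamma$ are at least bivalent; 2. no internal vertex of $\Gamma$ has valence $2$ with one incoming and one outgoing edge; 3. after deleting $\mathit{in}$ and $\mathit{out}$, no connected component of $\Gamma$ contains internal but no external vertices. \textbf{Definition/Proposition.} The moperad $\mathsf{fGraphs}_1$ over $\mathsf{fGraphs}$ contains $\mathsf{Graphs}_1$ as a sub-$\mathsf{Graphs}$-moperad. That is, the graded subspaces $\mathsf{fGraphs}_1(A)$ of the products over $k$ without the invariance condition are closed under the operations above, with insertions of elements of $\mathsf{fGraphs}$; and the graded subspaces $\mathsf{Graphs}_1(A)\subset\mathsf{fGraphs}_1(A)$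 contain the unit and are closed under bijections of the external labels, under $\delta$ (which has degree $+1$), under insertions $\Gamma\circ_a\gamma$ of $\gamma\in\mathsf{Graphs}(B)$ at external vertices $a$, and under moperadic composition (both of degree $0$). -/

import Mathlib

open scoped BigOperators

noncomputable section

namespace TwistedGraphs

/-! ### The operad `Gra` (undirected graphs) and the `Gra`-moperad `Gra₁` (directed graphs)

Arities are finite sets, as usual for symmetric sequences: the space of operations with inputs
labelled by `1, …, n` is the one for the label set `Fin n`.  Edges are odd, of degree `-1`, so that
linear combinations of graphs with vertex set `V`, an ordering of the edges and the sign rule for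
reorderings are the exterior algebra on the set of possible edges. -/

/-- Undirected edges (no tadpoles) on the vertex set `V`. -/
abbrev UEdge (V : Type) : Type := {s : Sym2 V // ¬ s.IsDiag}

/-- `Gra(V)`: linear combinations of undirected graphs with vertex set `V` and odd edges. -/
abbrev Gra (V : Type) : Type := ExteriorAlgebra ℝ (UEdge V →₀ ℝ)

/-- Directed edges (no tadpoles) on the vertices `in`, `out` and `V`.  Edges may start at `out` and
end at `in`, but not conversely: `src = none` means that the edge starts at `out`, and `tgt = none`
that it ends at `in`. -/
structure Arc (V : Type) where
  src : Option V
  tgt : Option V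
  loopless : ∀ v : V, ¬ (src = some v ∧ tgt = some v)

/-- `Gra₁(V)`: linear combinations of directed graphs with vertex set `{in, out} ⊔ V` and odd
edges. -/
abbrev Gra₁ (V : Type) : Type := ExteriorAlgebra ℝ (Arc V →₀ ℝ)

/-- The graph in `Gra` with the edges in the list `l`, in this order. -/
def Gra.graph {V : Type} (l : List (UEdge V)) : Gra V :=
  (l.map fun e => ExteriorAlgebra.ι ℝ (Finsupp.single e (1 : ℝ))).prod

/-- The graph in `Gra₁` with the edges in the list `l`, in this order. -/
def Gra₁.graph {V : Type} (l : List (Arc V)) : Gra₁ V :=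
  (l.map fun e => ExteriorAlgebra.ι ℝ (Finsupp.single e (1 : ℝ))).prod

open Classical in
/-- The directed edge from `a` (`none` is `out`) to `b` (`none` is `in`), as a generator; tadpoles
are zero. -/
def arc {V : Type} (a b : Option V) : Arc V →₀ ℝ :=
  if h : ∀ v : V, ¬ (a = some v ∧ b = some v) then Finsupp.single ⟨a, b, h⟩ 1 else 0

/-- Reconnect edges in all possible ways: an edge from `a` to `b` becomes the sum of the edges from
a vertex in `s a` to a vertex in `t b`, independently for the different edges. -/
def reconnect {V W : Type} (s t : Option V → Finset (Option W)) : Gra₁ V →ₐ[ℝ] Gra₁ W :=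
  ExteriorAlgebra.map
    (Finsupp.linearCombination ℝ fun e : Arc V => ∑ a ∈ s e.src, ∑ b ∈ t e.tgt, arc a b)

/-- Rename the numbered vertices. -/
def Gra₁.relabel {V W : Type} (φ : V → W) : Gra₁ V →ₐ[ℝ] Gra₁ W :=
  reconnect (fun a => {a.map φ}) (fun b => {b.map φ})

/-- Rename the vertices. -/
def Gra.relabel {V W : Type} (φ : V ↪ W) : Gra V →ₐ[ℝ] Gra W :=
  ExteriorAlgebra.map
    (Finsupp.lmapDomain ℝ ℝ fun e : UEdge V =>
      (⟨e.1.map φ, fun h => e.2 ((Sym2.isDiag_map φ.injective).1 h)⟩ : UEdge W))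

/-- An undirected graph on `B`, placed on the vertices `j b` of a directed one: each undirected edge
is the sum of the two directed ones. -/
def orient {B W : Type} (j : B → W) : Gra B →ₐ[ℝ] Gra₁ W :=
  ExteriorAlgebra.map
    (Finsupp.linearCombination ℝ fun e : UEdge B =>
      Sym2.lift ⟨fun u v => arc (some (j u)) (some (j v)) + arc (some (j v)) (some (j u)),
        fun _ _ => add_comm _ _⟩ e.1)

/-- The right action of `Gra` on `Gra₁`: insert `γ` at the vertex `v` of `Γ`, and reconnect the
edges at `v` to the vertices of `γ` in all possible ways. -/
def Gra₁.insert {V B : Type} [DecidableEq V] [Fintype B] (v : V) (Γ : Gra₁ V) (γ : Gra B) :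
    Gra₁ ({u : V // u ≠ v} ⊕ B) :=
  let spread : Option V → Finset (Option ({u : V // u ≠ v} ⊕ B)) := fun a =>
    match a with
    | none => {none}
    | some u =>
      if h : u = v then
        (Finset.univ : Finset B).map (Function.Embedding.inr.trans Function.Embedding.some)
      else {some (Sum.inl ⟨u, h⟩)}
  reconnect spread spread Γ * orient Sum.inr γ

/-- The moperadic composition in `Gra₁`: `Γ'` is plugged into the input of `Γ`.  The vertex `in` of
`Γ` and the vertex `out` of `Γ'` disappear; the edges of `Γ` that end at `in` are reconnected in all
possible ways to `in` or a numbered vertex of `Γ'`, and those of `Γ'` that start at `out` are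
reconnected in all possible ways to `out` or a numbered vertex of `Γ`. -/
def Gra₁.comp {U V : Type} [Fintype U] [Fintype V] (Γ : Gra₁ U) (Γ' : Gra₁ V) : Gra₁ (U ⊕ V) :=
  reconnect
      (fun a => {a.map Sum.inl})
      (fun b =>
        match b with
        | none => (Finset.univ : Finset (Option V)).map Function.Embedding.inr.optionMap
        | some u => {some (Sum.inl u)}) Γ *
    reconnect
      (fun a =>
        match a with
        | none => (Finset.univ : Finset (Option U)).map Function.Embedding.inl.optionMap
        | some v => {some (Sum.inr v)})
      (fun b => {b.map Sum.inr}) Γ'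

/-- The Maurer–Cartan element for the twist of `Gra` (the image of the Lie bracket): the graph with
two vertices and one edge. -/
def lieEdge : Gra (Fin 2) :=
  Gra.graph [⟨s(0, 1), by simp⟩]

/-- The Maurer–Cartan element for the twist of `Gra₁` (the Lie derivative): the graph with one
numbered vertex `•` and the edge `• → in`, minus the one with the edge `out → •`. -/
def lieDer : Gra₁ Unit :=
  ExteriorAlgebra.ι ℝ (arc (some ()) none) - ExteriorAlgebra.ι ℝ (arc none (some ()))

/-- The sign `(-1)^|Γ|`, that is `(-1)` to the number of edges. -/
def parity {V : Type} : Gra₁ V →ₐ[ℝ] Gra₁ V :=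
  ExteriorAlgebra.map (-LinearMap.id)

/-! ### The twists

The twist of a symmetric sequence `P` has the operations `∏ₖ (P(A ⊔ {1, …, k}) ⊗ ℝ[-2]^{⊗ k})^{Sₖ}`
of arity `A`: (possibly infinite) linear combinations of graphs with external vertices `Sum.inl a`,
and indistinguishable internal vertices `Sum.inr i`, each of the even degree `2`.  The operations
below are those of the twist, written on the product without the invariance condition. -/

/-- `∏ₖ Gra(B ⊔ {1, …, k})`. -/
abbrev PreTw (B : Type) : Type := (k : ℕ) → Gra (B ⊕ Fin k)

/-- `∏ₖ Gra₁(A ⊔ {1, …, k})`. -/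
abbrev PreTw₁ (A : Type) : Type := (k : ℕ) → Gra₁ (A ⊕ Fin k)

/-- Rename the external vertices. -/
def twRelabel {A A' : Type} (φ : A ≃ A') (f : PreTw₁ A) : PreTw₁ A' := fun k =>
  Gra₁.relabel (Sum.map φ id) (f k)

/-- The unit: the graph without numbered vertices and edges. -/
def twUnit : PreTw₁ Empty := fun k => if k = 0 then 1 else 0

/-- The moperadic composition, summed over all distributions of the `k` internal vertices. -/
def twComp {A B : Type} [Fintype A] [Fintype B] (f : PreTw₁ A) (g : PreTw₁ B) :
    PreTw₁ (A ⊕ B) := fun k =>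
  ∑ S : Finset (Fin k),
    Gra₁.relabel
      (Sum.elim (Sum.map Sum.inl (S.orderEmbOfFin rfl)) (Sum.map Sum.inr (Sᶜ.orderEmbOfFin rfl)))
      (Gra₁.comp (f S.card) (g Sᶜ.card))

/-- The right action: insertion of `g` at the external vertex `a` of `f`, summed over all
distributions of the `k` internal vertices. -/
def twInsert {A B : Type} [DecidableEq A] [Fintype B] (a : A) (f : PreTw₁ A) (g : PreTw B) :
    PreTw₁ ({x : A // x ≠ a} ⊕ B) := fun k =>
  ∑ S : Finset (Fin k),
    Gra₁.relabel
      (Sum.elim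
        (fun u : {u : A ⊕ Fin S.card // u ≠ Sum.inl a} =>
          match u with
          | ⟨Sum.inl x, h⟩ => Sum.inl (Sum.inl ⟨x, fun hx => h (congrArg Sum.inl hx)⟩)
          | ⟨Sum.inr i, _⟩ => Sum.inr (S.orderEmbOfFin rfl i))
        (Sum.map Sum.inr (Sᶜ.orderEmbOfFin rfl)))
      (Gra₁.insert (Sum.inl a) (f S.card) (g Sᶜ.card))

/-- The splitting of `v` into `v` and the new internal vertex `x`, connected by an edge. -/
def splitAt {A : Type} [DecidableEq A] {k : ℕ} (x : Fin (k + 1)) (v : A ⊕ Fin k)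
    (Γ : Gra₁ (A ⊕ Fin k)) : Gra₁ (A ⊕ Fin (k + 1)) :=
  let old : A ⊕ Fin k → A ⊕ Fin (k + 1) := Sum.map id x.succAbove
  Gra₁.relabel (Sum.elim (fun u : {u : A ⊕ Fin k // u ≠ v} => old u) ![old v, Sum.inr x])
    (Gra₁.insert v Γ lieEdge)

/-- The part of the differential in which `x` is the new internal vertex:
`m ∘ Γ - (-1)^|Γ| (Γ ∘ m + ∑ₐ Γ ∘ₐ b + ½ ∑ᵢ Γ ∘ᵢ b)`, where `m` and `b` are the Maurer–Cartan
elements `lieDer` and `lieEdge`, `a` runs over the external and `i` over the internal vertices. -/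
def diffAt {A : Type} [Fintype A] [DecidableEq A] {k : ℕ} (x : Fin (k + 1))
    (Γ : Gra₁ (A ⊕ Fin k)) : Gra₁ (A ⊕ Fin (k + 1)) :=
  let old : A ⊕ Fin k → A ⊕ Fin (k + 1) := Sum.map id x.succAbove
  Gra₁.relabel (Sum.elim (fun _ => Sum.inr x) old) (Gra₁.comp lieDer Γ)
    - (Gra₁.relabel (Sum.elim old (fun _ => Sum.inr x)) (Gra₁.comp (parity Γ) lieDer)
      + ∑ a : A, splitAt x (Sum.inl a) (parity Γ)
      + (1 / 2 : ℝ) • ∑ i : Fin k, splitAt x (Sum.inr i) (parity Γ))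

/-- The twisted differential. -/
def twDiff {A : Type} [Fintype A] [DecidableEq A] (f : PreTw₁ A) : PreTw₁ A := fun k =>
  match k with
  | 0 => 0
  | k + 1 => ∑ x : Fin (k + 1), diffAt x (f k)

/-- The span of the graphs in `Gra(V)` (without multiple edges) with the property `P`. -/
def Gra.spanOf {V : Type} (P : List (UEdge V) → Prop) : Submodule ℝ (Gra V) :=
  Submodule.span ℝ {Γ | ∃ l : List (UEdge V), l.Nodup ∧ P l ∧ Γ = Gra.graph l}

/-- The span of the graphs in `Gra₁(V)` (without multiple edges) with the property `P`. -/
def Gra₁.spanOf {V : Type} (P : List (Arc V) → Prop) : Submodule ℝ (Gra₁ V) :=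
  Submodule.span ℝ {Γ | ∃ l : List (Arc V), l.Nodup ∧ P l ∧ Γ = Gra₁.graph l}

/-- The elements of degree `d` in the twist of `Gra` that are spanned by graphs with the property
`P`.  A graph with `k` internal vertices and `e` edges has degree `2k - e`. -/
def twSpan (B : Type) (d : ℤ) (P : (k : ℕ) → List (UEdge (B ⊕ Fin k)) → Prop) :
    Submodule ℝ (PreTw B) where
  carrier := {f |
    (∀ k (σ : Equiv.Perm (Fin k)),
      Gra.relabel ((Equiv.refl B).sumCongr σ).toEmbedding (f k) = f k) ∧
    ∀ k : ℕ, f k ∈ Gra.spanOf fun l => (l.length : ℤ) = 2 * (k : ℤ) - d ∧ P k l}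
  add_mem' := fun hf hg => ⟨fun k σ => by
    simp only [Pi.add_apply, map_add, hf.1 k σ, hg.1 k σ], fun k => add_mem (hf.2 k) (hg.2 k)⟩
  zero_mem' := ⟨fun _ _ => map_zero _, fun _ => zero_mem _⟩
  smul_mem' := fun c f hf => ⟨fun k σ => by
    simp only [Pi.smul_apply, map_smul, hf.1 k σ], fun k => Submodule.smul_mem _ c (hf.2 k)⟩

/-- The elements of degree `d` in the twist of `Gra₁` that are spanned by graphs with the property
`P`.  A graph with `k` internal vertices and `e` edges has degree `2k - e`. -/
def twSpan₁ (A : Type) (d : ℤ) (P : (k : ℕ) → List (Arc (A ⊕ Fin k)) → Prop) :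
    Submodule ℝ (PreTw₁ A) where
  carrier := {f |
    (∀ k (σ : Equiv.Perm (Fin k)), Gra₁.relabel (Sum.map id σ) (f k) = f k) ∧
    ∀ k : ℕ, f k ∈ Gra₁.spanOf fun l => (l.length : ℤ) = 2 * (k : ℤ) - d ∧ P k l}
  add_mem' := fun hf hg => ⟨fun k σ => by
    simp only [Pi.add_apply, map_add, hf.1 k σ, hg.1 k σ], fun k => add_mem (hf.2 k) (hg.2 k)⟩
  zero_mem' := ⟨fun _ _ => map_zero _, fun _ => zero_mem _⟩
  smul_mem' := fun c f hf => ⟨fun k σ => by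
    simp only [Pi.smul_apply, map_smul, hf.1 k σ], fun k => Submodule.smul_mem _ c (hf.2 k)⟩

/-! ### `fGraphs`, `Graphs`, `fGraphs₁` and `Graphs₁` -/

/-- The degree `d` part of `fGraphs(B) = Tw Gra(B)`. -/
def fGraphs (B : Type) (d : ℤ) : Submodule ℝ (PreTw B) := twSpan B d fun _ _ => True

/-- The degree `d` part of `fGraphs₁(A) = Tw Gra₁(A)`. -/
def fGraphs₁ (A : Type) (d : ℤ) : Submodule ℝ (PreTw₁ A) := twSpan₁ A d fun _ _ => True

/-- The valence of a vertex of an undirected graph. -/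
def valence {V : Type} (l : List (UEdge V)) (v : V) : ℕ := {e | e ∈ l ∧ v ∈ e.1}.ncard

/-- The number of edges that end at `v`. -/
def inValence {V : Type} (l : List (Arc V)) (v : V) : ℕ := {e | e ∈ l ∧ e.tgt = some v}.ncard

/-- The number of edges that start at `v`. -/
def outValence {V : Type} (l : List (Arc V)) (v : V) : ℕ := {e | e ∈ l ∧ e.src = some v}.ncard

/-- The simple graph on the vertex set `V` underlying an undirected graph. -/
def skeleton {V : Type} (l : List (UEdge V)) : SimpleGraph V :=
  SimpleGraph.fromEdgeSet {s | ∃ e ∈ l, e.1 = s}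

/-- The simple graph on the vertex set `V` underlying a directed graph after deletion of `in` and
`out`. -/
def innerSkeleton {V : Type} (l : List (Arc V)) : SimpleGraph V :=
  SimpleGraph.fromRel fun u v => ∃ e ∈ l, e.src = some u ∧ e.tgt = some v

/-- The graphs that span `Graphs`: all internal vertices are at least trivalent, and no connected
component contains only internal vertices. -/
structure IsGraphsGraph {B : Type} (k : ℕ) (l : List (UEdge (B ⊕ Fin k))) : Prop where
  trivalent : ∀ i : Fin k, 3 ≤ valence l (Sum.inr i)
  connected : ∀ C : (skeleton l).ConnectedComponent, ∃ b : B, Sum.inl b ∈ C.supp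

/-- The graphs that span `Graphs₁`. -/
structure IsGraphs₁Graph {A : Type} (k : ℕ) (l : List (Arc (A ⊕ Fin k))) : Prop where
  bivalent : ∀ i : Fin k, 2 ≤ inValence l (Sum.inr i) + outValence l (Sum.inr i)
  no_passing : ∀ i : Fin k, ¬ (inValence l (Sum.inr i) = 1 ∧ outValence l (Sum.inr i) = 1)
  connected : ∀ C : (innerSkeleton l).ConnectedComponent,
    (∃ i : Fin k, Sum.inr i ∈ C.supp) → ∃ a : A, Sum.inl a ∈ C.supp

/-- The degree `d` part of `Graphs(B)`. -/
def Graphs (B : Type) (d : ℤ) : Submodule ℝ (PreTw B) := twSpan B d IsGraphsGraph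

/-- The degree `d` part of `Graphs₁(A)`. -/
def Graphs₁ (A : Type) (d : ℤ) : Submodule ℝ (PreTw₁ A) := twSpan₁ A d IsGraphs₁Graph

/-- The graded subspaces `M(A)` of the twist of `Gra₁` are closed under all operations of a
differential graded moperad over `P`, where `P(B)` are graded subspaces of the twist of `Gra`. -/
structure IsSubMoperad (P : (B : Type) → ℤ → Submodule ℝ (PreTw B))
    (M : (A : Type) → ℤ → Submodule ℝ (PreTw₁ A)) : Prop where
  unit_mem : twUnit ∈ M Empty 0
  relabel_mem : ∀ {A A' : Type} [Finite A] (φ : A ≃ A') {d : ℤ} {f : PreTw₁ A},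
    f ∈ M A d → twRelabel φ f ∈ M A' d
  diff_mem : ∀ {A : Type} [Fintype A] [DecidableEq A] {d : ℤ} {f : PreTw₁ A},
    f ∈ M A d → twDiff f ∈ M A (d + 1)
  insert_mem : ∀ {A B : Type} [Finite A] [DecidableEq A] [Fintype B] (a : A) {d e : ℤ}
    {f : PreTw₁ A} {g : PreTw B},
    f ∈ M A d → g ∈ P B e → twInsert a f g ∈ M ({x : A // x ≠ a} ⊕ B) (d + e)
  comp_mem : ∀ {A B : Type} [Fintype A] [Fintype B] {d e : ℤ} {f : PreTw₁ A} {g : PreTw₁ B},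
    f ∈ M A d → g ∈ M B e → twComp f g ∈ M (A ⊕ B) (d + e)

end TwistedGraphs

end

/-!
The exterior algebra on the set of edges has the squarefree monomials as a basis, up to sign
(`mem_monomialSpan_forall`).  Hence it makes sense to speak of the graphs that occur in an element,
and each closure property is a statement about the graphs that occur in the result of an operation.
A vertex satisfies the two valence conditions of `Graphs₁` if and only if at least two edges end at
it or at least two edges start at it (`IsSaturated`).  The connectivity condition says that every
internal vertex is joined to an external one by a path that avoids `in` and `out` (`IsAnchored`).

Insertion and moperadic composition reconnect edges at `in`, `out` and one external vertex only, so
they decrease no in- or out-valence of an internal vertex and keep the paths to external vertices,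
or lead them into the inserted graph (`IsGood.insert`, `IsGood.comp`).

The differential creates a new internal vertex `x` (`newVertex`, `diffAt_eq`).  A graph that occurs
in it is anchored as soon as `x` is saturated (`newVertex_mem_anchored`), so it remains to be shown
that the graphs with an unsaturated internal vertex `y` cancel.  The graphs in which `y` is
saturated span a two-sided ideal, and everything happens modulo this ideal.  Terms in which `y` is
neither the new vertex nor split lie in the ideal.  Splitting `y` into `y` and the new vertex `x`
is, by invariance under permutations of the internal vertices, the same as splitting `x` into `x`
and the new vertex `y`; so the two coefficients `1 / 2` add up, and the claim becomes that the
differential in which *all* vertices are split with coefficient `1` vanishes modulo the ideal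
(`newVertex_one_mem_saturatedSpan`).  This holds by induction on the number of edges.  Write `D Γ`
for this differential; if `Γ` has no edges, then the single edges at `y` of which `D Γ` consists
cancel.  Let `e = (s → t)` be an edge.  Since the new edge is odd,
`D (e Γ) + e D Γ` consists of the terms in which `e` itself is reconnected to `y`.  Modulo the ideal
only `-(s → y)(y → t) Γ`, which comes from the splitting of `s` (or from `out`), and
`-(y → t)(s → y) Γ`, which comes from the splitting of `t` (or from `in`), survive
(`src_terms_mem`, `tgt_terms_mem`), and they cancel.

Invariance of the results under permutations of the internal vertices is naturality of the
operations (`relabel_comp`, `relabel_insert`, `relabel_newVertex`).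
-/

noncomputable section

namespace TwistedGraphs

/-! ### Monomials in the exterior algebra of a free module -/

section Monomial

variable {X Y : Type*}

/-- The product, in this order, of the generators in the list `l`.  Both `Gra.graph` and
`Gra₁.graph` are instances of it. -/
def monomial (l : List X) : ExteriorAlgebra ℝ (X →₀ ℝ) :=
  (l.map fun e => ExteriorAlgebra.ι ℝ (Finsupp.single e (1 : ℝ))).prod

/-- The span of the squarefree monomials with the property `P`.  Both `Gra.spanOf` and
`Gra₁.spanOf` are instances of it. -/
def monomialSpan (P : List X → Prop) : Submodule ℝ (ExteriorAlgebra ℝ (X →₀ ℝ)) :=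
  Submodule.span ℝ {g | ∃ l : List X, l.Nodup ∧ P l ∧ g = monomial l}

@[simp]
theorem monomial_nil : monomial ([] : List X) = 1 := rfl

theorem monomial_cons (e : X) (l : List X) :
    monomial (e :: l) = ExteriorAlgebra.ι ℝ (Finsupp.single e (1 : ℝ)) * monomial l := by
  simp [monomial]

theorem monomial_append (l l' : List X) : monomial (l ++ l') = monomial l * monomial l' := by
  simp [monomial]

theorem ι_mul_monomial_of_mem {e : X} {l : List X} (h : e ∈ l) :
    ExteriorAlgebra.ι ℝ (Finsupp.single e (1 : ℝ)) * monomial l = 0 := by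
  induction l with
  | nil => simp at h
  | cons e' l ih =>
    rw [monomial_cons, ← mul_assoc]
    rcases List.mem_cons.1 h with rfl | h
    · rw [ExteriorAlgebra.ι_sq_zero, zero_mul]
    · rw [eq_neg_of_add_eq_zero_left (ExteriorAlgebra.ι_add_mul_swap _ _), neg_mul, mul_assoc, ih h,
        mul_zero, neg_zero]

theorem monomial_of_not_nodup {l : List X} (h : ¬ l.Nodup) : monomial l = 0 := by
  induction l with
  | nil => simp at h
  | cons e l ih =>
    rw [monomial_cons]
    by_cases he : e ∈ l
    · exact ι_mul_monomial_of_mem he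
    · rw [ih fun hl => h (List.nodup_cons.2 ⟨he, hl⟩), mul_zero]

theorem monomial_mem_monomialSpan {P : List X → Prop} {l : List X} (h : l.Nodup → P l) :
    monomial l ∈ monomialSpan P := by
  by_cases hl : l.Nodup
  · exact Submodule.subset_span ⟨l, hl, h hl, rfl⟩
  · rw [monomial_of_not_nodup hl]; exact zero_mem _

theorem monomialSpan_le {P : List X → Prop} {N : Submodule ℝ (ExteriorAlgebra ℝ (X →₀ ℝ))}
    (h : ∀ l : List X, l.Nodup → P l → monomial l ∈ N) : monomialSpan P ≤ N := by
  rw [monomialSpan, Submodule.span_le]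
  rintro _ ⟨l, hl, hP, rfl⟩
  exact h l hl hP

theorem monomialSpan_mono {P Q : List X → Prop} (h : ∀ l : List X, l.Nodup → P l → Q l) :
    monomialSpan P ≤ monomialSpan Q :=
  monomialSpan_le fun l hl hP => monomial_mem_monomialSpan fun _ => h l hl hP

theorem ι_single_mem_monomialSpan {P : List X → Prop} {e : X} (h : P [e]) :
    ExteriorAlgebra.ι ℝ (Finsupp.single e (1 : ℝ)) ∈ monomialSpan P := by
  have := monomial_mem_monomialSpan (P := P) (l := [e]) fun _ => h
  simpa [monomial_cons] using this

theorem one_mem_monomialSpan {P : List X → Prop} (h : P []) :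
    (1 : ExteriorAlgebra ℝ (X →₀ ℝ)) ∈ monomialSpan P := by
  simpa using monomial_mem_monomialSpan (P := P) (l := []) fun _ => h

theorem mul_mem_monomialSpan {P Q R : List X → Prop} {f g : ExteriorAlgebra ℝ (X →₀ ℝ)}
    (hf : f ∈ monomialSpan P) (hg : g ∈ monomialSpan Q)
    (h : ∀ l l', (l ++ l').Nodup → P l → Q l' → R (l ++ l')) :
    f * g ∈ monomialSpan R := by
  have key : monomialSpan P ≤ (monomialSpan R).comap (LinearMap.mulRight ℝ g) := by
    refine monomialSpan_le fun l _ hP => ?_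
    have : monomialSpan Q ≤ (monomialSpan R).comap (LinearMap.mulLeft ℝ (monomial l)) :=
      monomialSpan_le fun l' _ hQ => by
        change monomial l * monomial l' ∈ monomialSpan R
        rw [← monomial_append]
        exact monomial_mem_monomialSpan fun hn => h l l' hn hP hQ
    exact this hg
  exact key hf

theorem mem_monomialSpan_true (f : ExteriorAlgebra ℝ (X →₀ ℝ)) :
    f ∈ monomialSpan fun _ : List X => True := by
  induction f using ExteriorAlgebra.induction with
  | algebraMap r =>
    rw [Algebra.algebraMap_eq_smul_one]
    exact Submodule.smul_mem _ _ (one_mem_monomialSpan trivial)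
  | ι x =>
    induction x using Finsupp.induction_linear with
    | zero => simp
    | add x y hx hy => rw [map_add]; exact add_mem hx hy
    | single e c =>
      rw [← mul_one c, ← smul_eq_mul, ← Finsupp.smul_single, map_smul]
      exact Submodule.smul_mem _ _ (ι_single_mem_monomialSpan trivial)
  | mul a b ha hb => exact mul_mem_monomialSpan ha hb fun _ _ _ _ _ => trivial
  | add a b ha hb => exact add_mem ha hb

/-- If a map of exterior algebras sends each generator `e` to a combination of generators `e'` with
`R e e'`, then it sends a monomial to a combination of monomials whose factors are related to the
given ones by `R`. -/
theorem map_monomial_mem {L : (X →₀ ℝ) →ₗ[ℝ] (Y →₀ ℝ)} {R : X → Y → Prop}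
    (hL : ∀ e, L (Finsupp.single e 1) ∈
      Submodule.span ℝ {g | ∃ e', R e e' ∧ g = Finsupp.single e' (1 : ℝ)}) (l : List X) :
    ExteriorAlgebra.map L (monomial l) ∈ monomialSpan (List.Forall₂ R l) := by
  induction l with
  | nil => simpa using one_mem_monomialSpan .nil
  | cons e l ih =>
    have he : ExteriorAlgebra.ι ℝ (L (Finsupp.single e 1)) ∈
        monomialSpan fun l' : List Y => ∃ e', R e e' ∧ l' = [e'] := by
      have hle : Submodule.span ℝ {g | ∃ e', R e e' ∧ g = Finsupp.single e' (1 : ℝ)} ≤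
          (monomialSpan fun l' : List Y => ∃ e', R e e' ∧ l' = [e']).comap
            (ExteriorAlgebra.ι ℝ) := by
        rw [Submodule.span_le]
        rintro _ ⟨e', he', rfl⟩
        exact ι_single_mem_monomialSpan ⟨e', he', rfl⟩
      exact hle (hL e)
    rw [monomial_cons, map_mul, ExteriorAlgebra.map_apply_ι]
    refine mul_mem_monomialSpan he ih ?_
    rintro _ l' _ ⟨e', he', rfl⟩ hl'
    exact .cons he' hl'

theorem map_mem_monomialSpan {L : (X →₀ ℝ) →ₗ[ℝ] (Y →₀ ℝ)} {R : X → Y → Prop}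
    (hL : ∀ e, L (Finsupp.single e 1) ∈
      Submodule.span ℝ {g | ∃ e', R e e' ∧ g = Finsupp.single e' (1 : ℝ)})
    {P : List X → Prop} {Q : List Y → Prop}
    (h : ∀ l l', l.Nodup → l'.Nodup → P l → List.Forall₂ R l l' → Q l')
    {f : ExteriorAlgebra ℝ (X →₀ ℝ)} (hf : f ∈ monomialSpan P) :
    ExteriorAlgebra.map L f ∈ monomialSpan Q := by
  have : monomialSpan P ≤ (monomialSpan Q).comap (ExteriorAlgebra.map L).toLinearMap :=
    monomialSpan_le fun l hl hP =>
      monomialSpan_mono (fun l' hl' hR => h l l' hl hl' hP hR) (map_monomial_mem hL l)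
  exact this hf

theorem exists_monomial_eq_smul_of_perm {l l' : List X} (h : l.Perm l') :
    ∃ c : ℝ, monomial l = c • monomial l' := by
  induction h with
  | nil => exact ⟨1, by simp⟩
  | cons e _ ih =>
    obtain ⟨c, hc⟩ := ih
    exact ⟨c, by rw [monomial_cons, monomial_cons, hc, mul_smul_comm]⟩
  | swap e e' l =>
    refine ⟨-1, ?_⟩
    simp only [monomial_cons, ← mul_assoc]
    rw [eq_neg_of_add_eq_zero_left (ExteriorAlgebra.ι_add_mul_swap _ _), neg_mul, neg_one_smul]
  | trans _ _ ih ih' =>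
    obtain ⟨c, hc⟩ := ih
    obtain ⟨c', hc'⟩ := ih'
    exact ⟨c * c', by rw [hc, hc', smul_smul]⟩

/-- Up to sign the squarefree monomials form a basis of the exterior algebra.  Therefore an element
that is a combination of monomials with the property `P i`, for each `i`, is a combination of
monomials that have all these properties. -/
theorem mem_monomialSpan_forall {ι : Type*} {P : ι → List X → Prop}
    (hP : ∀ i l l', l.Perm l' → P i l → P i l') {f : ExteriorAlgebra ℝ (X →₀ ℝ)}
    (hf : ∀ i, f ∈ monomialSpan (P i)) : f ∈ monomialSpan fun l => ∀ i, P i l := by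
  classical
  let : LinearOrder X := IsWellOrder.linearOrder WellOrderingRel
  let b := (Finsupp.basisSingleOne (R := ℝ) (ι := X)).ExteriorAlgebra
  have hb : ∀ s : Finset X, ∃ l : List X, l.Nodup ∧ l.toFinset = s ∧ b s = monomial l := by
    intro s
    have hmem : ∀ x, x ∈ List.ofFn (s.orderEmbOfFin rfl) ↔ x ∈ s := fun x => by
      rw [List.mem_ofFn', Finset.range_orderEmbOfFin, Finset.mem_coe]
    refine ⟨List.ofFn (s.orderEmbOfFin rfl),
      List.nodup_ofFn.2 (s.orderEmbOfFin rfl).injective, ?_, ?_⟩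
    · ext x
      rw [List.mem_toFinset, hmem]
    · rw [ExteriorAlgebra.basis_apply_ofCard _ rfl, ExteriorAlgebra.ιMulti_family,
        ExteriorAlgebra.ιMulti_apply, monomial, List.map_ofFn]
      simp only [Function.comp_def, Finsupp.coe_basisSingleOne]
      rfl
  choose L hL hLs hbL using hb
  have hperm : ∀ {l : List X}, l.Nodup → l.Perm (L l.toFinset) := fun hl =>
    (List.perm_ext_iff_of_nodup hl (hL _)).2 fun a => by
      rw [← List.mem_toFinset, ← List.mem_toFinset, hLs]
  have hspan : ∀ i, monomialSpan (P i) ≤ Submodule.span ℝ (b '' {s | P i (L s)}) := fun i =>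
    monomialSpan_le fun l hl hPl => by
      obtain ⟨c, hc⟩ := exists_monomial_eq_smul_of_perm (hperm hl)
      rw [hc, ← hbL]
      exact Submodule.smul_mem _ _
        (Submodule.subset_span ⟨_, hP i _ _ (hperm hl) hPl, rfl⟩)
  have hsupp : ∀ i, ↑(b.repr f).support ⊆ {s | P i (L s)} := fun i =>
    b.mem_span_image.1 (hspan i (hf i))
  have hmem : f ∈ Submodule.span ℝ (b '' {s | ∀ i, P i (L s)}) :=
    b.mem_span_image.2 fun s hs i => hsupp i hs
  refine (Submodule.span_le.2 ?_ : Submodule.span ℝ (b '' {s | ∀ i, P i (L s)}) ≤ _) hmem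
  rintro _ ⟨s, hs, rfl⟩
  rw [hbL]
  exact monomial_mem_monomialSpan fun _ => hs

theorem mem_monomialSpan_and {P Q : List X → Prop} (hP : ∀ l l', l.Perm l' → P l → P l')
    (hQ : ∀ l l', l.Perm l' → Q l → Q l') {f : ExteriorAlgebra ℝ (X →₀ ℝ)}
    (hfP : f ∈ monomialSpan P) (hfQ : f ∈ monomialSpan Q) :
    f ∈ monomialSpan fun l => P l ∧ Q l := by
  have := mem_monomialSpan_forall (P := fun b : Bool => if b then P else Q)
    (by rintro (_ | _); exacts [hQ, hP]) (f := f) (by rintro (_ | _); exacts [hfQ, hfP])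
  exact monomialSpan_mono (fun l _ h => ⟨h true, h false⟩) this

end Monomial

/-! ### Edges and homomorphisms of `Gra₁` -/

section Edge

variable {U V W B : Type}

/-- The directed edge from `a` (`none` is `out`) to `b` (`none` is `in`), as an element of `Gra₁`;
tadpoles are zero. -/
def edge (a b : Option V) : Gra₁ V := ExteriorAlgebra.ι ℝ (arc a b)

theorem arc_src_tgt (e : Arc V) : arc e.src e.tgt = Finsupp.single e (1 : ℝ) := dif_pos e.loopless

theorem arc_some_self (v : V) : arc (some v) (some v) = 0 := dif_neg fun h => h v ⟨rfl, rfl⟩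

@[simp]
theorem edge_some_self (v : V) : edge (some v) (some v) = 0 := by
  rw [edge, arc_some_self, map_zero]

theorem ι_single (e : Arc V) :
    ExteriorAlgebra.ι ℝ (Finsupp.single e (1 : ℝ)) = edge e.src e.tgt := by
  rw [edge, arc_src_tgt]

theorem Gra₁.algHom_ext {B : Type*} [Ring B] [Algebra ℝ B] {F G : Gra₁ V →ₐ[ℝ] B}
    (h : ∀ a b : Option V, (∀ v, ¬ (a = some v ∧ b = some v)) → F (edge a b) = G (edge a b)) :
    F = G := by
  refine ExteriorAlgebra.hom_ext (Finsupp.lhom_ext' fun e => LinearMap.ext_ring ?_)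
  simpa only [LinearMap.comp_apply, AlgHom.toLinearMap_apply, Finsupp.lsingle_apply, ι_single]
    using h _ _ e.loopless

theorem reconnect_edge (s t : Option V → Finset (Option W)) {a b : Option V}
    (h : ∀ v, ¬ (a = some v ∧ b = some v)) :
    reconnect s t (edge a b) = ∑ a' ∈ s a, ∑ b' ∈ t b, edge a' b' := by
  simp only [edge, reconnect, ExteriorAlgebra.map_apply_ι]
  rw [arc, dif_pos h]
  simp

/-- A tadpole is mapped to a tadpole, hence zero to zero; so no condition on the edge is needed. -/
@[simp]
theorem relabel_edge (φ : V → W) (a b : Option V) :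
    Gra₁.relabel φ (edge a b) = edge (a.map φ) (b.map φ) := by
  by_cases h : ∀ v, ¬ (a = some v ∧ b = some v)
  · simp [Gra₁.relabel, reconnect_edge _ _ h]
  · push Not at h
    obtain ⟨v, rfl, rfl⟩ := h
    simp

theorem relabel_relabel (ψ : V → W) (φ : U → V) (Γ : Gra₁ U) :
    Gra₁.relabel ψ (Gra₁.relabel φ Γ) = Gra₁.relabel (ψ ∘ φ) Γ := by
  have : (Gra₁.relabel ψ).comp (Gra₁.relabel φ) = Gra₁.relabel (ψ ∘ φ) :=
    Gra₁.algHom_ext fun a b _ => by simp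
  exact DFunLike.congr_fun this Γ

theorem relabel_reconnect (ψ : V → W) (s t : Option U → Finset (Option V)) (Γ : Gra₁ U)
    {F : Gra₁ U →ₐ[ℝ] Gra₁ W}
    (hF : ∀ a b : Option U, (∀ v, ¬ (a = some v ∧ b = some v)) →
      F (edge a b) = ∑ a' ∈ s a, ∑ b' ∈ t b, edge (a'.map ψ) (b'.map ψ)) :
    Gra₁.relabel ψ (reconnect s t Γ) = F Γ := by
  have : (Gra₁.relabel ψ).comp (reconnect s t) = F :=
    Gra₁.algHom_ext fun a b h => by simp [reconnect_edge _ _ h, hF a b h]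
  exact DFunLike.congr_fun this Γ

theorem orient_ι (j : B → V) (u v : B) (h : ¬ s(u, v).IsDiag) :
    orient j (ExteriorAlgebra.ι ℝ (Finsupp.single ⟨s(u, v), h⟩ (1 : ℝ))) =
      edge (some (j u)) (some (j v)) + edge (some (j v)) (some (j u)) := by
  simp [orient, ExteriorAlgebra.map_apply_ι, edge]

theorem Gra.algHom_ext {R : Type*} [Ring R] [Algebra ℝ R] {F G : Gra V →ₐ[ℝ] R}
    (h : ∀ (u v : V) (h : ¬ s(u, v).IsDiag),
      F (ExteriorAlgebra.ι ℝ (Finsupp.single ⟨s(u, v), h⟩ (1 : ℝ))) =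
        G (ExteriorAlgebra.ι ℝ (Finsupp.single ⟨s(u, v), h⟩ (1 : ℝ)))) :
    F = G := by
  refine ExteriorAlgebra.hom_ext (Finsupp.lhom_ext' fun e => LinearMap.ext_ring ?_)
  obtain ⟨s, hs⟩ := e
  induction s using Sym2.ind with
  | h u v => exact h u v hs

theorem relabel_orient {B : Type} (ψ : V → W) (j : B → V) (γ : Gra B) :
    Gra₁.relabel ψ (orient j γ) = orient (ψ ∘ j) γ := by
  have : (Gra₁.relabel ψ).comp (orient j) = orient (ψ ∘ j) :=
    Gra.algHom_ext fun u v h => by simp [orient_ι]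
  exact DFunLike.congr_fun this γ

theorem orient_relabel {C : Type} (j : C → V) (φ : B ↪ C) (γ : Gra B) :
    orient j (Gra.relabel φ γ) = orient (j ∘ φ) γ := by
  have : (orient j).comp (Gra.relabel φ) = orient (j ∘ φ) :=
    Gra.algHom_ext fun u v h => by
      have h' : ¬ s(φ u, φ v).IsDiag := fun hd => h (by simpa using hd)
      have := orient_ι j (φ u) (φ v) h'
      simp only [orient_ι, AlgHom.comp_apply, Function.comp_apply]
      rw [← this, Gra.relabel, ExteriorAlgebra.map_apply_ι, Finsupp.lmapDomain_apply,
        Finsupp.mapDomain_single]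
      rfl
  exact DFunLike.congr_fun this γ

/-- Moving an odd element past `Γ` produces the sign `(-1)^|Γ|`. -/
theorem parity_mul_ι (Γ : Gra₁ V) (m : Arc V →₀ ℝ) :
    parity Γ * ExteriorAlgebra.ι ℝ m = ExteriorAlgebra.ι ℝ m * Γ := by
  induction Γ using ExteriorAlgebra.induction with
  | algebraMap r => rw [AlgHom.commutes, Algebra.commutes]
  | ι x =>
    rw [parity, ExteriorAlgebra.map_apply_ι, LinearMap.neg_apply, LinearMap.id_apply, map_neg,
      neg_mul, eq_comm, eq_neg_iff_add_eq_zero, ExteriorAlgebra.ι_add_mul_swap]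
  | mul a b ha hb => rw [map_mul, mul_assoc, hb, ← mul_assoc, ha, mul_assoc]
  | add a b ha hb => rw [map_add, add_mul, mul_add, ha, hb]

theorem parity_mul_edge (Γ : Gra₁ V) (a b : Option V) : parity Γ * edge a b = edge a b * Γ :=
  parity_mul_ι Γ _

theorem edge_mul_edge (a b a' b' : Option V) : edge a b * edge a' b' = -(edge a' b' * edge a b) :=
  eq_neg_of_add_eq_zero_left (ExteriorAlgebra.ι_add_mul_swap _ _)

theorem edge_mul_edge_mul (a b a' b' : Option V) (Γ : Gra₁ V) :
    edge a b * (edge a' b' * Γ) = -(edge a' b' * (edge a b * Γ)) := by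
  rw [← mul_assoc, edge_mul_edge, neg_mul, mul_assoc]

theorem parity_map (L : (Arc V →₀ ℝ) →ₗ[ℝ] (Arc W →₀ ℝ)) (Γ : Gra₁ V) :
    ExteriorAlgebra.map L (parity Γ) = parity (ExteriorAlgebra.map L Γ) := by
  have : (ExteriorAlgebra.map L).comp parity = parity.comp (ExteriorAlgebra.map L) :=
    ExteriorAlgebra.hom_ext (LinearMap.ext fun x => by
      simp [parity])
  exact DFunLike.congr_fun this Γ

/-! ### The graphs that occur after reconnecting edges -/

theorem arc_mem_span {R : Arc V → Prop} {a b : Option V}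
    (h : ∀ e : Arc V, e.src = a → e.tgt = b → R e) :
    arc a b ∈ Submodule.span ℝ {g | ∃ e, R e ∧ g = Finsupp.single e (1 : ℝ)} := by
  by_cases hab : ∀ v : V, ¬ (a = some v ∧ b = some v)
  · exact Submodule.subset_span ⟨⟨a, b, hab⟩, h _ rfl rfl, dif_pos hab⟩
  · rw [arc, dif_neg hab]; exact zero_mem _

theorem edge_mem_spanOf {P : List (Arc V) → Prop} {a b : Option V}
    (h : ∀ e : Arc V, e.src = a → e.tgt = b → P [e]) : edge a b ∈ Gra₁.spanOf P := by
  by_cases hab : ∀ v : V, ¬ (a = some v ∧ b = some v)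
  · rw [edge, arc, dif_pos hab]
    exact ι_single_mem_monomialSpan (h _ rfl rfl)
  · rw [edge, arc, dif_neg hab, map_zero]; exact zero_mem _

theorem reconnect_mem_spanOf (s t : Option V → Finset (Option W)) {P : List (Arc V) → Prop}
    {Γ : Gra₁ V} (hΓ : Γ ∈ Gra₁.spanOf P) :
    reconnect s t Γ ∈ Gra₁.spanOf fun l' => ∃ l, P l ∧
      List.Forall₂ (fun e e' : Arc _ => e'.src ∈ s e.src ∧ e'.tgt ∈ t e.tgt) l l' := by
  refine map_mem_monomialSpan (fun e => ?_) (fun l l' _ _ hP hR => ⟨l, hP, hR⟩) hΓ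
  rw [Finsupp.linearCombination_single, one_smul]
  refine Submodule.sum_mem _ fun a ha => Submodule.sum_mem _ fun b hb => arc_mem_span ?_
  rintro e' rfl rfl
  exact ⟨ha, hb⟩

theorem relabel_mem_spanOf (φ : V → W) {P : List (Arc V) → Prop} {Γ : Gra₁ V}
    (hΓ : Γ ∈ Gra₁.spanOf P) :
    Gra₁.relabel φ Γ ∈ Gra₁.spanOf fun l' => ∃ l, P l ∧
      List.Forall₂ (fun e e' : Arc _ => e'.src = e.src.map φ ∧ e'.tgt = e.tgt.map φ) l l' := by
  have := reconnect_mem_spanOf (fun a => {a.map φ}) (fun b => {b.map φ}) hΓ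
  simp only [Finset.mem_singleton] at this
  exact this

theorem orient_mem_spanOf (j : B → V) {P : List (UEdge B) → Prop} {γ : Gra B}
    (hγ : γ ∈ Gra.spanOf P) :
    orient j γ ∈ Gra₁.spanOf fun l' => ∃ l, P l ∧
      List.Forall₂ (fun (e : UEdge B) (e' : Arc V) =>
        ∃ u v, e.1 = s(u, v) ∧ e'.src = some (j u) ∧ e'.tgt = some (j v)) l l' := by
  refine map_mem_monomialSpan (fun e => ?_) (fun l l' _ _ hP hR => ⟨l, hP, hR⟩) hγ
  obtain ⟨s, hs⟩ := e
  induction s using Sym2.ind with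
  | h u v =>
    rw [Finsupp.linearCombination_single, one_smul]
    exact add_mem (arc_mem_span fun e' h₁ h₂ => ⟨u, v, rfl, h₁, h₂⟩)
      (arc_mem_span fun e' h₁ h₂ => ⟨v, u, Sym2.eq_swap, h₁, h₂⟩)

/-! ### Insertion as a reconnection -/

/-- The vertices to which an edge at `a` may be reconnected when a graph on `B` is inserted at the
vertex `v`. -/
def insertSpread [DecidableEq V] [Fintype B] (v : V) (a : Option V) :
    Finset (Option ({u : V // u ≠ v} ⊕ B)) :=
  match a with
  | none => {none}
  | some u =>
    if h : u = v then
      (Finset.univ : Finset B).map (Function.Embedding.inr.trans Function.Embedding.some)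
    else {some (Sum.inl ⟨u, h⟩)}

theorem insert_eq [DecidableEq V] [Fintype B] (v : V) (Γ : Gra₁ V) (γ : Gra B) :
    Gra₁.insert v Γ γ =
      reconnect (insertSpread v) (insertSpread v) Γ * orient Sum.inr γ := rfl

@[simp]
theorem insertSpread_none [DecidableEq V] [Fintype B] (v : V) :
    insertSpread (B := B) v none = {none} := rfl

@[simp]
theorem insertSpread_self [DecidableEq V] [Fintype B] (v : V) :
    insertSpread v (some v) =
      (Finset.univ : Finset B).map (Function.Embedding.inr.trans Function.Embedding.some) :=
  dif_pos rfl

theorem insertSpread_of_ne [DecidableEq V] [Fintype B] {u v : V} (h : u ≠ v) :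
    insertSpread (B := B) v (some u) = {some (Sum.inl ⟨u, h⟩)} := dif_neg h

end Edge

/-! ### Saturated and anchored vertices -/

section Good

variable {V W B : Type}

open Classical in
/-- The number of edges in the list `l`, counted with multiplicity, that end at `v`. -/
def inCount (l : List (Arc V)) (v : V) : ℕ := l.countP fun e => e.tgt = some v

open Classical in
/-- The number of edges in the list `l`, counted with multiplicity, that start at `v`. -/
def outCount (l : List (Arc V)) (v : V) : ℕ := l.countP fun e => e.src = some v

/-- At least two edges end at `v`, or at least two edges start at `v`.  This says that `v` is at
least bivalent and that it does not have just one incoming and one outgoing edge. -/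
def IsSaturated (l : List (Arc V)) (v : V) : Prop := 2 ≤ inCount l v ∨ 2 ≤ outCount l v

/-- After deletion of `in` and `out`, the component of `v` contains an external vertex; `I` is the
property of being internal. -/
def IsAnchored (I : V → Prop) (l : List (Arc V)) (v : V) : Prop :=
  ∃ w, ¬ I w ∧ (innerSkeleton l).Reachable v w

/-- The condition on the graphs that span `Graphs₁`, for any vertex set `V` and any property `I` of
being internal. -/
def IsGood (I : V → Prop) (l : List (Arc V)) : Prop :=
  ∀ v, I v → IsSaturated l v ∧ IsAnchored I l v

open Classical in
/-- The condition on the graphs that span `Graphs`, for any vertex set `V` and any property `I` of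
being internal. -/
def IsGoodUndirected (I : V → Prop) (l : List (UEdge V)) : Prop :=
  (∀ v, I v → 3 ≤ l.countP fun e => v ∈ e.1) ∧
    ∀ v, ∃ w, ¬ I w ∧ (skeleton l).Reachable v w

open Classical in
theorem ncard_mem_and {X : Type*} {l : List X} (hl : l.Nodup) (p : X → Prop) :
    {e | e ∈ l ∧ p e}.ncard = l.countP fun e => p e := by
  have : {e | e ∈ l ∧ p e} = ((l.filter fun e => p e).toFinset : Set X) := by
    ext e
    simp
  rw [this, Set.ncard_coe_finset, List.toFinset_card_of_nodup (hl.filter _),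
    List.countP_eq_length_filter]

theorem inValence_eq_inCount {l : List (Arc V)} (hl : l.Nodup) (v : V) :
    inValence l v = inCount l v := by
  rw [inValence, ncard_mem_and hl, inCount]
  congr!

theorem outValence_eq_outCount {l : List (Arc V)} (hl : l.Nodup) (v : V) :
    outValence l v = outCount l v := by
  rw [outValence, ncard_mem_and hl, outCount]
  congr!

theorem isGraphs₁Graph_iff {A : Type} {k : ℕ} {l : List (Arc (A ⊕ Fin k))} (hl : l.Nodup) :
    IsGraphs₁Graph k l ↔ IsGood (fun v => v.isRight = true) l := by
  have hin := inValence_eq_inCount hl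
  have hout := outValence_eq_outCount hl
  constructor
  · rintro h (a | i) hv
    · simp at hv
    · have h₁ := h.bivalent i
      have h₂ := h.no_passing i
      rw [hin, hout] at h₁ h₂
      obtain ⟨a, ha⟩ := h.connected ((innerSkeleton l).connectedComponentMk (Sum.inr i)) ⟨i, rfl⟩
      refine ⟨?_, Sum.inl a, by simp, ?_⟩
      · rw [IsSaturated]; omega
      · exact (SimpleGraph.ConnectedComponent.exact ha).symm
  · intro h
    have hs : ∀ i : Fin k, IsSaturated l (Sum.inr i) := fun i => (h (Sum.inr i) rfl).1
    refine ⟨fun i => ?_, fun i => ?_, ?_⟩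
    · have := hs i
      rw [hin, hout]; rw [IsSaturated] at this; omega
    · have := hs i
      rw [hin, hout]; rw [IsSaturated] at this; omega
    · rintro C ⟨i, hi⟩
      obtain ⟨a | j, hw, hr⟩ := (h (Sum.inr i) rfl).2
      · refine ⟨a, ?_⟩
        rw [SimpleGraph.ConnectedComponent.mem_supp_iff] at hi ⊢
        rw [← hi]
        exact SimpleGraph.ConnectedComponent.sound hr.symm
      · simp at hw

theorem IsGraphsGraph.isGoodUndirected {B : Type} {k : ℕ} {l : List (UEdge (B ⊕ Fin k))}
    (hl : l.Nodup) (h : IsGraphsGraph k l) : IsGoodUndirected (fun v => v.isRight = true) l := by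
  classical
  refine ⟨?_, fun v => ?_⟩
  · rintro (b | i) hv
    · simp at hv
    · refine (h.trivalent i).trans_eq ?_
      rw [valence, ncard_mem_and hl]
      congr!
  · obtain ⟨b, hb⟩ := h.connected ((skeleton l).connectedComponentMk v)
    exact ⟨Sum.inl b, by simp, (SimpleGraph.ConnectedComponent.exact hb).symm⟩

theorem countP_le_of_forall₂ {X Y : Type*} {R : X → Y → Prop} {p : X → Bool} {q : Y → Bool}
    (h : ∀ e e', R e e' → p e = true → q e' = true) {l : List X} {l' : List Y}
    (hl : List.Forall₂ R l l') : l.countP p ≤ l'.countP q := by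
  induction hl with
  | nil => simp
  | @cons e e' _ _ hR _ ih =>
    rw [List.countP_cons, List.countP_cons]
    have := h e e' hR
    split_ifs <;> first | omega | simp_all

theorem inCount_le_of_forall₂ {R : Arc V → Arc W → Prop} {v : V} {w : W}
    (h : ∀ e e', R e e' → e.tgt = some v → e'.tgt = some w) {l : List (Arc V)} {l' : List (Arc W)}
    (hl : List.Forall₂ R l l') : inCount l v ≤ inCount l' w :=
  countP_le_of_forall₂ (by simpa using h) hl

theorem outCount_le_of_forall₂ {R : Arc V → Arc W → Prop} {v : V} {w : W}
    (h : ∀ e e', R e e' → e.src = some v → e'.src = some w) {l : List (Arc V)} {l' : List (Arc W)}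
    (hl : List.Forall₂ R l l') : outCount l v ≤ outCount l' w :=
  countP_le_of_forall₂ (by simpa using h) hl

theorem IsSaturated.of_forall₂ {R : Arc V → Arc W → Prop} {v : V} {w : W}
    (h : ∀ e e', R e e' →
      (e.src = some v → e'.src = some w) ∧ (e.tgt = some v → e'.tgt = some w))
    {l : List (Arc V)} {l' : List (Arc W)} (hl : List.Forall₂ R l l') (hs : IsSaturated l v) :
    IsSaturated l' w :=
  hs.imp (fun h' => h'.trans (inCount_le_of_forall₂ (fun e e' hR => (h e e' hR).2) hl))
    (fun h' => h'.trans (outCount_le_of_forall₂ (fun e e' hR => (h e e' hR).1) hl))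

theorem inCount_append (l l' : List (Arc V)) (v : V) :
    inCount (l ++ l') v = inCount l v + inCount l' v := List.countP_append

theorem outCount_append (l l' : List (Arc V)) (v : V) :
    outCount (l ++ l') v = outCount l v + outCount l' v := List.countP_append

theorem IsSaturated.append_right {l : List (Arc V)} {v : V} (h : IsSaturated l v)
    (l' : List (Arc V)) : IsSaturated (l ++ l') v := by
  rw [IsSaturated, inCount_append, outCount_append]
  rw [IsSaturated] at h
  omega

theorem IsSaturated.append_left {l : List (Arc V)} {v : V} (h : IsSaturated l v)
    (l' : List (Arc V)) : IsSaturated (l' ++ l) v := by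
  rw [IsSaturated, inCount_append, outCount_append]
  rw [IsSaturated] at h
  omega

theorem IsSaturated.perm {l l' : List (Arc V)} {v : V} (h : IsSaturated l v) (hl : l.Perm l') :
    IsSaturated l' v := by
  rw [IsSaturated, inCount, outCount] at h ⊢
  rwa [← hl.countP_eq, ← hl.countP_eq]

theorem reachable_of_mem {l : List (Arc V)} {e : Arc V} (he : e ∈ l) {u v : V}
    (hu : e.src = some u) (hv : e.tgt = some v) : (innerSkeleton l).Reachable u v := by
  refine SimpleGraph.Adj.reachable ((SimpleGraph.fromRel_adj _ _ _).2 ⟨?_, .inl ⟨e, he, hu, hv⟩⟩)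
  rintro rfl
  exact e.loopless _ ⟨hu, hv⟩

theorem exists_mem_of_adj {l : List (Arc V)} {u v : V} (h : (innerSkeleton l).Adj u v) :
    (∃ e ∈ l, e.src = some u ∧ e.tgt = some v) ∨ ∃ e ∈ l, e.src = some v ∧ e.tgt = some u :=
  ((SimpleGraph.fromRel_adj _ _ _).1 h).2

theorem IsAnchored.of_not {I : V → Prop} {l : List (Arc V)} {v : V} (hv : ¬ I v) :
    IsAnchored I l v := ⟨v, hv, .refl v⟩

theorem IsAnchored.of_reachable {I : V → Prop} {l : List (Arc V)} {u v : V} (hv : IsAnchored I l v)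
    (h : (innerSkeleton l).Reachable u v) : IsAnchored I l u :=
  hv.imp fun _ hw => ⟨hw.1, h.trans hw.2⟩

theorem IsAnchored.congr {I : V → Prop} {l : List (Arc V)} {u v : V}
    (h : (innerSkeleton l).Reachable u v) : IsAnchored I l u ↔ IsAnchored I l v :=
  ⟨fun hu => hu.of_reachable h.symm, fun hv => hv.of_reachable h⟩

theorem IsAnchored.perm {I : V → Prop} {l l' : List (Arc V)} {v : V} (h : IsAnchored I l v)
    (hl : l.Perm l') : IsAnchored I l' v := by
  have : innerSkeleton l = innerSkeleton l' := by
    simp only [innerSkeleton, hl.mem_iff]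
  rwa [IsAnchored, ← this]

/-- A property that holds for the external vertices and is shared by the ends of each edge holds
for the anchored vertices. -/
theorem IsAnchored.induction {I T : V → Prop} {l : List (Arc V)} (h₀ : ∀ w, ¬ I w → T w)
    (h : ∀ e ∈ l, ∀ u v, e.src = some u → e.tgt = some v → (T u ↔ T v)) {v : V}
    (hv : IsAnchored I l v) : T v := by
  obtain ⟨w, hw, ⟨p⟩⟩ := hv
  induction p with
  | nil => exact h₀ _ hw
  | cons hadj _ ih =>
    rcases exists_mem_of_adj hadj with ⟨e, he, hs, ht⟩ | ⟨e, he, hs, ht⟩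
    · exact (h e he _ _ hs ht).2 (ih hw)
    · exact (h e he _ _ hs ht).1 (ih hw)

theorem exists_right_of_forall₂ {X Y : Type*} {R : X → Y → Prop} {l : List X} {l' : List Y}
    (h : List.Forall₂ R l l') {e : X} (he : e ∈ l) : ∃ e' ∈ l', R e e' := by
  induction h with
  | nil => simp at he
  | cons hR _ ih =>
    rcases List.mem_cons.1 he with rfl | he
    · exact ⟨_, List.mem_cons_self, hR⟩
    · obtain ⟨e', he', hR'⟩ := ih he
      exact ⟨e', List.mem_cons_of_mem _ he', hR'⟩

/-- If each edge between numbered vertices becomes an edge between their images under `φ`, then the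
image of an anchored vertex is anchored. -/
theorem IsAnchored.map {I : V → Prop} {J : W → Prop} {φ : V → W} (hφ : ∀ v, ¬ I v → ¬ J (φ v))
    {l : List (Arc V)} {l' : List (Arc W)}
    (h : ∀ e ∈ l, ∀ u v, e.src = some u → e.tgt = some v →
      ∃ e' ∈ l', e'.src = some (φ u) ∧ e'.tgt = some (φ v))
    {v : V} (hv : IsAnchored I l v) : IsAnchored J l' (φ v) := by
  refine hv.induction (T := fun v => IsAnchored J l' (φ v)) (fun w hw => .of_not (hφ w hw)) ?_
  intro e he u v hu hv
  obtain ⟨e', he', hu', hv'⟩ := h e he u v hu hv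
  exact IsAnchored.congr (reachable_of_mem he' hu' hv')

/-! ### Relabelling, insertion and composition preserve the conditions on graphs -/

theorem IsGood.relabel {φ : V → W} {I : V → Prop} {J : W → Prop}
    (hJ : ∀ w, J w → ∃ v, I v ∧ φ v = w) (hI : ∀ v, ¬ I v → ¬ J (φ v))
    {l : List (Arc V)} {l' : List (Arc W)}
    (hl : List.Forall₂ (fun e e' => e'.src = e.src.map φ ∧ e'.tgt = e.tgt.map φ) l l')
    (h : IsGood I l) : IsGood J l' := by
  intro w hw
  obtain ⟨v, hv, rfl⟩ := hJ w hw
  refine ⟨(h v hv).1.of_forall₂ (fun e e' hR => ?_) hl, (h v hv).2.map hI fun e he u v hu hv => ?_⟩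
  · constructor <;> intro h' <;> simp [hR.1, hR.2, h']
  · obtain ⟨e', he', hs, ht⟩ := exists_right_of_forall₂ hl he
    exact ⟨e', he', by rw [hs, hu]; rfl, by rw [ht, hv]; rfl⟩

/-- The condition `c → _` allows for the full twists (`c` false) and the subspaces `Graphs` and
`Graphs₁` (`c` true) to be treated at the same time. -/
theorem relabel_mem {c : Prop} {n : ℤ} {φ : V → W} {I : V → Prop} {J : W → Prop}
    (hJ : ∀ w, J w → ∃ v, I v ∧ φ v = w) (hI : ∀ v, ¬ I v → ¬ J (φ v)) {Γ : Gra₁ V}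
    (hΓ : Γ ∈ Gra₁.spanOf fun l => (l.length : ℤ) = n ∧ (c → IsGood I l)) :
    Gra₁.relabel φ Γ ∈ Gra₁.spanOf fun l => (l.length : ℤ) = n ∧ (c → IsGood J l) :=
  monomialSpan_mono (fun _ _ ⟨_, hP, hR⟩ =>
    ⟨hR.length_eq ▸ hP.1, fun hc => (hP.2 hc).relabel hJ hI hR⟩) (relabel_mem_spanOf φ hΓ)

theorem IsGood.comp {I : V → Prop} {J : W → Prop} {l₁ : List (Arc V)} {l₂ : List (Arc W)}
    {m₁ m₂ : List (Arc (V ⊕ W))}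
    (hm₁ : List.Forall₂ (fun e e' => e'.src = e.src.map Sum.inl ∧
      ∀ u, e.tgt = some u → e'.tgt = some (Sum.inl u)) l₁ m₁)
    (hm₂ : List.Forall₂ (fun e e' => (∀ u, e.src = some u → e'.src = some (Sum.inr u)) ∧
      e'.tgt = e.tgt.map Sum.inr) l₂ m₂)
    (h₁ : IsGood I l₁) (h₂ : IsGood J l₂) : IsGood (Sum.elim I J) (m₁ ++ m₂) := by
  rintro (v | v) hv
  · refine ⟨((h₁ v hv).1.of_forall₂ (fun e e' hR => ⟨?_, hR.2 v⟩) hm₁).append_right _,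
      (h₁ v hv).2.map (J := Sum.elim I J) (fun _ h => h) fun e he u w hu hw => ?_⟩
    · intro h; simp [hR.1, h]
    · obtain ⟨e', he', hs, ht⟩ := exists_right_of_forall₂ hm₁ he
      exact ⟨e', List.mem_append_left _ he', by rw [hs, hu]; rfl, ht w hw⟩
  · refine ⟨((h₂ v hv).1.of_forall₂ (fun e e' hR => ⟨hR.1 v, ?_⟩) hm₂).append_left _,
      (h₂ v hv).2.map (J := Sum.elim I J) (fun _ h => h) fun e he u w hu hw => ?_⟩
    · intro h; simp [hR.2, h]
    · obtain ⟨e', he', hs, ht⟩ := exists_right_of_forall₂ hm₂ he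
      exact ⟨e', List.mem_append_right _ he', hs u hu, by rw [ht, hw]; rfl⟩

theorem comp_mem [Fintype V] [Fintype W] {c : Prop} {n m : ℤ} {I : V → Prop} {J : W → Prop}
    {Γ : Gra₁ V} (hΓ : Γ ∈ Gra₁.spanOf fun l => (l.length : ℤ) = n ∧ (c → IsGood I l))
    {Γ' : Gra₁ W} (hΓ' : Γ' ∈ Gra₁.spanOf fun l => (l.length : ℤ) = m ∧ (c → IsGood J l)) :
    Gra₁.comp Γ Γ' ∈
      Gra₁.spanOf fun l => (l.length : ℤ) = n + m ∧ (c → IsGood (Sum.elim I J) l) := by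
  refine mul_mem_monomialSpan
    (reconnect_mem_spanOf _ _ hΓ)
    (reconnect_mem_spanOf _ _ hΓ') ?_
  rintro m₁ m₂ - ⟨l₁, ⟨hn₁, h₁⟩, hR₁⟩ ⟨l₂, ⟨hn₂, h₂⟩, hR₂⟩
  refine ⟨?_, fun hc => IsGood.comp (hR₁.imp fun e e' h => ⟨?_, ?_⟩)
    (hR₂.imp fun e e' h => ⟨?_, ?_⟩) (h₁ hc) (h₂ hc)⟩
  · rw [List.length_append, ← hR₁.length_eq, ← hR₂.length_eq, Nat.cast_add, hn₁, hn₂]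
  · simpa using h.1
  · intro u hu; simpa [hu] using h.2
  · intro u hu; simpa [hu] using h.1
  · simpa using h.2

theorem skeleton_reachable_map {J : W → Prop} {l : List (UEdge B)} {l' : List (Arc W)} {j : B → W}
    (h : ∀ e ∈ l, ∃ e' ∈ l', ∃ u v, e.1 = s(u, v) ∧ e'.src = some (j u) ∧ e'.tgt = some (j v))
    {u w : B} (hr : (skeleton l).Reachable u w) (hw : IsAnchored J l' (j w)) :
    IsAnchored J l' (j u) := by
  obtain ⟨p⟩ := hr
  induction p with
  | nil => exact hw
  | cons hadj _ ih =>
    refine (ih hw).of_reachable ?_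
    obtain ⟨⟨e, he, hes⟩, -⟩ := (SimpleGraph.fromEdgeSet_adj _).1 hadj
    obtain ⟨e', he', u', v', huv, hu', hv'⟩ := h e he
    rw [hes, Sym2.eq_iff] at huv
    rcases huv with ⟨rfl, rfl⟩ | ⟨rfl, rfl⟩
    · exact reachable_of_mem he' hu' hv'
    · exact (reachable_of_mem he' hu' hv').symm

/-- An internal vertex whose component contains the vertex `v` at which the insertion takes place
remains anchored, since the edges at `v` are reconnected to vertices of the inserted graph, all of
which are anchored. -/
theorem IsGood.insert {v : V} {I : V → Prop} {J : B → Prop} {l₁ : List (Arc V)}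
    {l₂ : List (UEdge B)} {m₁ m₂ : List (Arc ({u : V // u ≠ v} ⊕ B))}
    (hm₁ : List.Forall₂ (fun e e' =>
      (∀ u (hu : u ≠ v), e.src = some u → e'.src = some (Sum.inl ⟨u, hu⟩)) ∧
      (∀ u (hu : u ≠ v), e.tgt = some u → e'.tgt = some (Sum.inl ⟨u, hu⟩)) ∧
      (e.src = some v → ∃ b, e'.src = some (Sum.inr b)) ∧
      (e.tgt = some v → ∃ b, e'.tgt = some (Sum.inr b))) l₁ m₁)
    (hm₂ : List.Forall₂ (fun e e' => ∃ u v, e.1 = s(u, v) ∧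
      e'.src = some (Sum.inr u) ∧ e'.tgt = some (Sum.inr v)) l₂ m₂)
    (h₁ : IsGood I l₁) (h₂ : IsGoodUndirected J l₂) :
    IsGood (Sum.elim (fun u : {u : V // u ≠ v} => I u) J) (m₁ ++ m₂) := by
  classical
  set K := Sum.elim (fun u : {u : V // u ≠ v} => I u) J with hK
  have hB : ∀ b, IsAnchored K (m₁ ++ m₂) (Sum.inr b) := fun b => by
    obtain ⟨w, hw, hr⟩ := h₂.2 b
    refine skeleton_reachable_map (fun e he => ?_) hr (.of_not hw)
    obtain ⟨e', he', h⟩ := exists_right_of_forall₂ hm₂ he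
    exact ⟨e', List.mem_append_right _ he', h⟩
  rintro (⟨u, hu⟩ | b) hI
  · refine ⟨((h₁ u hI).1.of_forall₂ (fun e e' hR => ⟨hR.1 u hu, hR.2.1 u hu⟩) hm₁).append_right _, ?_⟩
    refine (h₁ u hI).2.induction
      (T := fun u => ∀ hu : u ≠ v, IsAnchored K (m₁ ++ m₂) (Sum.inl ⟨u, hu⟩))
      (fun w hw _ => .of_not hw) ?_ hu
    intro e he u w hu hw
    obtain ⟨e', he', hs, ht, hs', ht'⟩ := exists_right_of_forall₂ hm₁ he
    have he' := List.mem_append_left m₂ he'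
    by_cases huv : u = v <;> by_cases hwv : w = v
    · subst huv hwv; rfl
    · obtain ⟨b, hb⟩ := hs' (huv ▸ hu)
      exact iff_of_true (fun h => absurd huv h)
        fun h => (hB b).of_reachable (reachable_of_mem he' hb (ht w h hw)).symm
    · obtain ⟨b, hb⟩ := ht' (hwv ▸ hw)
      exact iff_of_true (fun h => (hB b).of_reachable (reachable_of_mem he' (hs u h hu) hb))
        fun h => absurd hwv h
    · have := IsAnchored.congr (I := K) (reachable_of_mem he' (hs u huv hu) (ht w hwv hw))
      exact ⟨fun h h' => this.1 (h huv), fun h h' => this.2 (h hwv)⟩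
  · refine ⟨IsSaturated.append_left ?_ _, hB b⟩
    -- Each of the three undirected edges at `b` becomes an edge into or out of `b`, so that two of
    -- them have the same direction.
    have h₃ : l₂.countP (fun e => b ∈ e.1) ≤
        m₂.countP fun e => e.tgt = some (Sum.inr b) ∨ e.src = some (Sum.inr b) := by
      refine countP_le_of_forall₂ ?_ hm₂
      rintro e e' ⟨u, w, he, hs, ht⟩ hb
      simp only [he, decide_eq_true_eq, Sym2.mem_iff] at hb
      rcases hb with rfl | rfl <;> simp [hs, ht]
    have h₄ : ∀ m : List (Arc ({u : V // u ≠ v} ⊕ B)),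
        (m.countP fun e => e.tgt = some (Sum.inr b) ∨ e.src = some (Sum.inr b)) ≤
          inCount m (Sum.inr b) + outCount m (Sum.inr b) := by
      intro m
      simp only [inCount, outCount]
      induction m with
      | nil => simp
      | cons e m ih =>
        simp only [List.countP_cons, decide_eq_true_eq]
        split_ifs <;> first | omega | simp_all
    have h₅ := h₂.1 b hI
    have h₆ := h₄ m₂
    have h₇ : 3 ≤ l₂.countP (fun e => b ∈ e.1) := by convert h₅
    rw [IsSaturated]
    omega

theorem insert_mem [DecidableEq V] [Fintype B] {c : Prop} {n m : ℤ} {v : V} {I : V → Prop}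
    {J : B → Prop} {Γ : Gra₁ V}
    (hΓ : Γ ∈ Gra₁.spanOf fun l => (l.length : ℤ) = n ∧ (c → IsGood I l)) {γ : Gra B}
    (hγ : γ ∈ Gra.spanOf fun l => (l.length : ℤ) = m ∧ (c → IsGoodUndirected J l)) :
    Gra₁.insert v Γ γ ∈ Gra₁.spanOf fun l =>
      (l.length : ℤ) = n + m ∧ (c → IsGood (Sum.elim (fun u : {u : V // u ≠ v} => I u) J) l) := by
  rw [insert_eq]
  refine mul_mem_monomialSpan (reconnect_mem_spanOf _ _ hΓ)
    (orient_mem_spanOf _ hγ) ?_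
  rintro m₁ m₂ - ⟨l₁, ⟨hn₁, h₁⟩, hR₁⟩ ⟨l₂, ⟨hn₂, h₂⟩, hR₂⟩
  refine ⟨?_, fun hc => IsGood.insert (hR₁.imp fun e e' h => ?_) hR₂ (h₁ hc) (h₂ hc)⟩
  · rw [List.length_append, ← hR₁.length_eq, ← hR₂.length_eq, Nat.cast_add, hn₁, hn₂]
  · refine ⟨fun u hu he => ?_, fun u hu he => ?_, fun he => ?_, fun he => ?_⟩
    · simpa [he, insertSpread_of_ne hu] using h.1
    · simpa [he, insertSpread_of_ne hu] using h.2
    · simpa [he, eq_comm] using h.1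
    · simpa [he, eq_comm] using h.2

end Good

/-! ### Splitting off a new vertex -/

section Cut

variable {U V W : Type}

open Classical in
/-- The vertex `a` and, if `a` lies in `S`, also the vertex `x`. -/
def spread (x : W) (S : Finset (Option W)) (a : Option W) : Finset (Option W) :=
  if a ∈ S then {a, some x} else {a}

theorem mem_spread {x : W} {S : Finset (Option W)} {a a' : Option W} :
    a' ∈ spread x S a ↔ a' = a ∨ a ∈ S ∧ a' = some x := by
  rw [spread]
  split_ifs with h <;> simp [h]

theorem spread_of_notMem {x : W} {S : Finset (Option W)} {a : Option W} (h : a ∉ S) :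
    spread x S a = {a} := by
  ext; simp [mem_spread, h]

theorem sum_spread_of_mem {M : Type*} [AddCommMonoid M] {x : W} {S : Finset (Option W)}
    {a : Option W} (h : a ∈ S) (ha : a ≠ some x) (f : Option W → M) :
    ∑ a' ∈ spread x S a, f a' = f a + f (some x) := by
  classical
  rw [← Finset.sum_pair ha]
  congr 1
  ext; simp [mem_spread, h]

/-- Connect edges to the vertex `x`, in all possible ways: an edge that starts in `S` may
alternatively start at `x`, and an edge that ends in `T` may alternatively end at `x`. -/
def cut (x : W) (S T : Finset (Option W)) : Gra₁ W →ₐ[ℝ] Gra₁ W :=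
  reconnect (spread x S) (spread x T)

/-- The differential as an operator on graphs that already contain the new vertex `x` as an isolated
vertex, with the coefficient `c v` for the splitting of `v`.  The three terms are `m ∘ Γ`, `Γ ∘ m`
and the splittings of the vertices; the new edge is always put in front, which absorbs the sign
`(-1)^|Γ|`.  The sums over all vertices include `x` itself, where tadpoles make the summands
vanish. -/
def newVertex [Fintype W] (c : W → ℝ) (x : W) (Γ : Gra₁ W) : Gra₁ W :=
  ((∑ b, edge (some x) b) - edge none (some x)) * cut x {none} ∅ Γ
    - (edge (some x) none - ∑ a, edge a (some x)) * cut x ∅ {none} Γ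
    - ∑ v, c v • ((edge (some v) (some x) + edge (some x) (some v)) *
        cut x {some v} {some v} Γ)

theorem newVertex_isLinearMap [Fintype W] (c : W → ℝ) (x : W) :
    IsLinearMap ℝ (newVertex c x) where
  map_add Γ Γ' := by
    simp only [newVertex, map_add, mul_add, smul_add, Finset.sum_add_distrib]
    abel
  map_smul r Γ := by
    simp only [newVertex, map_smul, mul_smul_comm, smul_sub, Finset.smul_sum, smul_comm r]

theorem cut_edge (x : W) (S T : Finset (Option W)) {a b : Option W}
    (h : ∀ v, ¬ (a = some v ∧ b = some v)) :
    cut x S T (edge a b) = ∑ a' ∈ spread x S a, ∑ b' ∈ spread x T b, edge a' b' :=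
  reconnect_edge _ _ h

open Classical in
theorem cut_edge_of_ne {x : W} (S T : Finset (Option W)) {a b : Option W}
    (h : ∀ v, ¬ (a = some v ∧ b = some v)) (ha : a ≠ some x) (hb : b ≠ some x) :
    cut x S T (edge a b) = edge a b + (if a ∈ S then edge (some x) b else 0) +
      if b ∈ T then edge a (some x) else 0 := by
  rw [cut_edge x S T h]
  by_cases haS : a ∈ S <;> by_cases hbT : b ∈ T <;>
    simp [haS, hbT, sum_spread_of_mem, spread_of_notMem, ha, hb]
  abel

theorem map_noLoop {φ : V → W} (hφ : φ.Injective) {a b : Option V}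
    (h : ∀ v, ¬ (a = some v ∧ b = some v)) (v : W) : ¬ (a.map φ = some v ∧ b.map φ = some v) := by
  rintro ⟨h₁, h₂⟩
  obtain ⟨u, rfl, rfl⟩ := Option.map_eq_some_iff.1 h₁
  obtain ⟨w, rfl, hw⟩ := Option.map_eq_some_iff.1 h₂
  exact h u ⟨rfl, congrArg some (hφ hw)⟩

theorem spread_map (σ : Equiv.Perm W) (x : W) (S : Finset (Option W)) (a : Option W) :
    spread (σ x) (S.map σ.toEmbedding.optionMap) (a.map σ) =
      (spread x S a).map σ.toEmbedding.optionMap := by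
  have ha : a.map σ = σ.toEmbedding.optionMap a := rfl
  have hx : some (σ x) = σ.toEmbedding.optionMap (some x) := rfl
  ext b
  simp only [Finset.mem_map, mem_spread, ha, hx, EmbeddingLike.apply_eq_iff_eq]
  constructor
  · rintro (rfl | ⟨⟨a', ha', rfl⟩, rfl⟩)
    · exact ⟨a, .inl rfl, rfl⟩
    · exact ⟨some x, .inr ⟨ha', rfl⟩, rfl⟩
  · rintro ⟨b, rfl | ⟨h, rfl⟩, rfl⟩
    · exact .inl rfl
    · exact .inr ⟨⟨a, h, rfl⟩, rfl⟩

theorem relabel_cut (σ : Equiv.Perm W) (x : W) (S T : Finset (Option W)) (Γ : Gra₁ W) :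
    Gra₁.relabel σ (cut x S T Γ) =
      cut (σ x) (S.map σ.toEmbedding.optionMap) (T.map σ.toEmbedding.optionMap)
        (Gra₁.relabel σ Γ) := by
  have : (Gra₁.relabel σ).comp (cut x S T) =
      (cut (σ x) (S.map σ.toEmbedding.optionMap) (T.map σ.toEmbedding.optionMap)).comp
        (Gra₁.relabel σ) :=
    Gra₁.algHom_ext fun a b h => by
      simp only [AlgHom.comp_apply, relabel_edge, cut_edge _ _ _ h,
        cut_edge _ _ _ (map_noLoop σ.injective h), map_sum, spread_map, Finset.sum_map]
      rfl
  exact DFunLike.congr_fun this Γ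

theorem relabel_newVertex [Fintype W] {c : W → ℝ} (σ : Equiv.Perm W) (hc : ∀ v, c (σ v) = c v)
    (x : W) (Γ : Gra₁ W) :
    Gra₁.relabel σ (newVertex c x Γ) = newVertex c (σ x) (Gra₁.relabel σ Γ) := by
  have h₁ : ∑ b : Option W, edge (some (σ x)) (b.map σ) = ∑ b, edge (some (σ x)) b :=
    (Equiv.optionCongr σ).sum_comp fun b => edge (some (σ x)) b
  have h₂ : ∑ b : Option W, edge (b.map σ) (some (σ x)) = ∑ b, edge b (some (σ x)) :=
    (Equiv.optionCongr σ).sum_comp fun b => edge b (some (σ x))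
  simp only [newVertex, map_sub, map_mul, map_sum, map_smul, map_add, relabel_edge, relabel_cut,
    Option.map_some, Option.map_none, Finset.map_singleton, Finset.map_empty, h₁, h₂]
  congr 1
  exact Fintype.sum_equiv σ _ _ fun v => by rw [hc]; rfl

/-- Splitting `y` into `y` and `x` is the same as splitting `x` into `x` and `y` after the
exchange of `x` and `y`, for graphs that do not contain `x`. -/
theorem cut_relabel_swap [DecidableEq W] {φ : V → W} (hφ : φ.Injective) {x : W}
    (hx : ∀ v, φ v ≠ x) (y : W) (Γ : Gra₁ V) :
    cut x {some y} {some y} (Gra₁.relabel φ Γ) =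
      cut y {some x} {some x} (Gra₁.relabel (Equiv.swap x y ∘ φ) Γ) := by
  have hspread : ∀ a : Option V,
      spread x {some y} (a.map φ) = spread y {some x} (a.map (Equiv.swap x y ∘ φ)) := by
    intro a
    ext b
    rcases a with _ | v
    · simp [mem_spread]
    · by_cases hv : φ v = y
      · simp [mem_spread, hv, or_comm]
      · simp [mem_spread, hv, Equiv.swap_apply_of_ne_of_ne (hx v) hv, hx v]
  have : (cut x {some y} {some y}).comp (Gra₁.relabel φ) =
      (cut y {some x} {some x}).comp (Gra₁.relabel (Equiv.swap x y ∘ φ)) :=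
    Gra₁.algHom_ext fun a b h => by
      simp only [AlgHom.comp_apply, relabel_edge, cut_edge _ _ _ (map_noLoop hφ h),
        cut_edge _ _ _ (map_noLoop ((Equiv.swap x y).injective.comp hφ) h), hspread]
  exact DFunLike.congr_fun this Γ

theorem cut_mem_spanOf (x : W) (S T : Finset (Option W)) {P : List (Arc W) → Prop} {Γ : Gra₁ W}
    (hΓ : Γ ∈ Gra₁.spanOf P) :
    cut x S T Γ ∈ Gra₁.spanOf fun l' => ∃ l, P l ∧
      List.Forall₂ (fun e e' : Arc W =>
        (e'.src = e.src ∨ e.src ∈ S ∧ e'.src = some x) ∧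
        (e'.tgt = e.tgt ∨ e.tgt ∈ T ∧ e'.tgt = some x)) l l' := by
  have := reconnect_mem_spanOf (spread x S) (spread x T) hΓ
  simp only [mem_spread] at this
  exact this

/-! ### The differential in terms of the new vertex -/

theorem lieDer_eq : lieDer = edge (some ()) none - edge none (some ()) := rfl

theorem sum_edge_left [Fintype V] (φ : V → W) (x : W) :
    ∑ b ∈ (Finset.univ : Finset (Option V)).map Function.Embedding.inr.optionMap,
      Gra₁.relabel (Sum.elim (fun _ : Unit => x) φ) (edge (some (Sum.inl ())) b) =
    ∑ b : Option V, edge (some x) (b.map φ) := by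
  rw [Finset.sum_map]
  refine Finset.sum_congr rfl fun b _ => ?_
  rcases b with _ | b <;> simp

theorem sum_edge_right [Fintype V] (φ : V → W) (x : W) :
    ∑ a ∈ (Finset.univ : Finset (Option V)).map Function.Embedding.inl.optionMap,
      Gra₁.relabel (Sum.elim φ (fun _ : Unit => x)) (edge a (some (Sum.inr ()))) =
    ∑ a : Option V, edge (a.map φ) (some x) := by
  rw [Finset.sum_map]
  refine Finset.sum_congr rfl fun b _ => ?_
  rcases b with _ | b <;> simp

theorem relabel_lieDer_comp [Fintype V] {φ : V → W} (hφ : φ.Injective) (x : W)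
    (Γ : Gra₁ V) :
    Gra₁.relabel (Sum.elim (fun _ : Unit => x) φ) (Gra₁.comp lieDer Γ) =
      ((∑ b : Option V, edge (some x) (b.map φ)) - edge none (some x)) *
        cut x {none} ∅ (Gra₁.relabel φ Γ) := by
  rw [Gra₁.comp, map_mul]
  congr 1
  · rw [lieDer_eq, map_sub, reconnect_edge _ _ (by simp), reconnect_edge _ _ (by simp)]
    simp only [Option.map_some, Option.map_none, Finset.sum_singleton, map_sub, map_sum,
      sum_edge_left]
    simp
  · refine relabel_reconnect _ _ _ _ (F := (cut x {none} ∅).comp (Gra₁.relabel φ)) fun a b h => ?_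
    rw [AlgHom.comp_apply, relabel_edge, cut_edge _ _ _ (map_noLoop hφ h),
      spread_of_notMem (S := ∅) (by simp)]
    rcases a with _ | a
    · rw [Option.map_none, sum_spread_of_mem (by simp) (by simp)]
      simp [Fintype.sum_option, Function.comp_def]
    · rw [spread_of_notMem (by simp)]
      simp [Function.comp_def]

theorem cut_relabel_parity (x : W) (S T : Finset (Option W)) (φ : V → W) (Γ : Gra₁ V) :
    cut x S T (Gra₁.relabel φ (parity Γ)) = parity (cut x S T (Gra₁.relabel φ Γ)) := by
  rw [Gra₁.relabel, reconnect, parity_map, cut, reconnect, parity_map]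

theorem relabel_comp_lieDer [Fintype V] {φ : V → W} (hφ : φ.Injective) (x : W)
    (Γ : Gra₁ V) :
    Gra₁.relabel (Sum.elim φ (fun _ : Unit => x)) (Gra₁.comp (parity Γ) lieDer) =
      (edge (some x) none - ∑ a : Option V, edge (a.map φ) (some x)) *
        cut x ∅ {none} (Gra₁.relabel φ Γ) := by
  rw [Gra₁.comp, map_mul, relabel_reconnect _ _ _ _
    (F := (cut x ∅ {none}).comp (Gra₁.relabel φ)), AlgHom.comp_apply, cut_relabel_parity]
  · rw [lieDer_eq, map_sub, reconnect_edge _ _ (by simp), reconnect_edge _ _ (by simp)]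
    simp only [Option.map_some, Option.map_none, Finset.sum_singleton, map_sub, map_sum,
      sum_edge_right]
    simp only [relabel_edge, Option.map_some, Option.map_none, Sum.elim_inr, mul_sub, sub_mul,
      Finset.mul_sum, Finset.sum_mul, parity_mul_edge]
  · intro a b h
    rw [AlgHom.comp_apply, relabel_edge, cut_edge _ _ _ (map_noLoop hφ h),
      spread_of_notMem (S := ∅) (by simp), Finset.sum_singleton]
    rcases b with _ | b
    · rw [Option.map_none, sum_spread_of_mem (by simp) (by simp)]
      simp [Fintype.sum_option, Function.comp_def]
    · rw [spread_of_notMem (by simp)]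
      simp [Function.comp_def]

theorem relabel_insert_lieEdge [DecidableEq V] {φ : V → W} (hφ : φ.Injective) {x : W}
    (hx : ∀ v, φ v ≠ x) (v : V) (Γ : Gra₁ V) :
    Gra₁.relabel (Sum.elim (fun u : {u : V // u ≠ v} => φ u) ![φ v, x])
        (Gra₁.insert v (parity Γ) lieEdge) =
      (edge (some (φ v)) (some x) + edge (some x) (some (φ v))) *
        cut x {some (φ v)} {some (φ v)} (Gra₁.relabel φ Γ) := by
  have hlie : Gra₁.relabel (Sum.elim (fun u : {u : V // u ≠ v} => φ u) ![φ v, x])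
      (orient Sum.inr lieEdge) =
        edge (some (φ v)) (some x) + edge (some x) (some (φ v)) := by
    rw [relabel_orient, lieEdge, Gra.graph]
    simp [orient_ι]
  have hmem : ∀ u : V, some (φ u) ∈ ({some (φ v)} : Finset (Option W)) ↔ u = v := fun u => by
    simp [hφ.eq_iff]
  rw [insert_eq, map_mul, hlie, relabel_reconnect _ _ _ _
    (F := (cut x {some (φ v)} {some (φ v)}).comp (Gra₁.relabel φ)), AlgHom.comp_apply,
    cut_relabel_parity]
  · simp only [mul_add, add_mul, parity_mul_edge]
  · intro a b h
    have hsum : ∀ (a : Option V) (f : Option W → Gra₁ W),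
        ∑ a' ∈ spread x {some (φ v)} (a.map φ), f a' =
          ∑ a' ∈ insertSpread v a,
            f (a'.map (Sum.elim (fun u : {u : V // u ≠ v} => φ u) ![φ v, x])) := by
      rintro (_ | u) f
      · rw [Option.map_none, spread_of_notMem (by simp)]
        simp
      · by_cases hu : u = v
        · subst hu
          rw [Option.map_some, sum_spread_of_mem (by simp) (by simpa using hx u)]
          simp
        · rw [Option.map_some, spread_of_notMem (by rwa [hmem])]
          simp [insertSpread_of_ne hu]
    rw [AlgHom.comp_apply, relabel_edge, cut_edge _ _ _ (map_noLoop hφ h), hsum a]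
    exact Finset.sum_congr rfl fun a' _ => hsum b _

/-- The new vertex `Sum.inr x` and the old vertices exhaust all vertices. -/
theorem sum_option_sum_fin {M : Type*} [AddCommMonoid M] {A : Type} [Fintype A] {k : ℕ}
    (x : Fin (k + 1)) (f : Option (A ⊕ Fin (k + 1)) → M) :
    ∑ b, f b = f (some (Sum.inr x)) + ∑ b, f (Option.map (Sum.map id x.succAbove) b) := by
  simp only [Fintype.sum_option, Fintype.sum_sum_type, Fin.sum_univ_succAbove _ x]
  simp only [Option.map_none, Option.map_some, Sum.map_inl, Sum.map_inr, id]
  abel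

theorem succAbove_map_injective {A : Type} {k : ℕ} (x : Fin (k + 1)) :
    (Sum.map id x.succAbove : A ⊕ Fin k → A ⊕ Fin (k + 1)).Injective :=
  Sum.map_injective.2 ⟨Function.injective_id, Fin.succAbove_right_injective⟩

theorem succAbove_map_ne {A : Type} {k : ℕ} (x : Fin (k + 1)) (v : A ⊕ Fin k) :
    Sum.map id x.succAbove v ≠ Sum.inr x := by
  rcases v with a | i <;> simp

theorem diffAt_eq {A : Type} [Fintype A] [DecidableEq A] {k : ℕ} (x : Fin (k + 1))
    (Γ : Gra₁ (A ⊕ Fin k)) :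
    diffAt x Γ = newVertex (Sum.elim (fun _ => 1) fun _ => 1 / 2) (Sum.inr x)
      (Gra₁.relabel (Sum.map id x.succAbove) Γ) := by
  have hφ := succAbove_map_injective (A := A) x
  simp only [diffAt, splitAt, newVertex]
  rw [relabel_lieDer_comp hφ, relabel_comp_lieDer hφ]
  simp only [relabel_insert_lieEdge hφ (succAbove_map_ne x)]
  rw [sum_option_sum_fin x fun b => edge (some (Sum.inr x)) b,
    sum_option_sum_fin x fun b => edge b (some (Sum.inr x)), Fintype.sum_sum_type,
    Fin.sum_univ_succAbove _ x]
  simp only [edge_some_self, zero_add, add_zero, zero_mul, smul_zero, Sum.elim_inl, Sum.elim_inr,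
    one_smul, Sum.map_inl, Sum.map_inr, id, Finset.smul_sum]
  abel

end Cut

/-! ### Graphs in the image of the differential are anchored -/

section Differential

variable {V W : Type}

/-- No edge touches the vertex `x`. -/
def IsIsolated (l : List (Arc W)) (x : W) : Prop := ∀ e ∈ l, e.src ≠ some x ∧ e.tgt ≠ some x

theorem Arc.eq_of_src_eq_of_tgt_eq (e : Arc W) {e' : Arc W} (h₁ : e.src = e'.src)
    (h₂ : e.tgt = e'.tgt) : e = e' := by
  obtain ⟨a, b, _⟩ := e
  obtain ⟨a', b', _⟩ := e'
  simp only at h₁ h₂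
  subst h₁ h₂
  rfl

/-- A saturated vertex has a neighbour other than `in` and `out`, because there are no multiple
edges. -/
theorem IsSaturated.exists_neighbour {l : List (Arc W)} (hl : l.Nodup) {x : W}
    (h : IsSaturated l x) :
    ∃ e ∈ l, ∃ v, e.src = some x ∧ e.tgt = some v ∨ e.src = some v ∧ e.tgt = some x := by
  -- Otherwise the only edges at `x` are the ones from `out` to `x` and from `x` to `in`.
  by_contra! hne
  have hin : inCount l x ≤ 1 := by
    rw [← inValence_eq_inCount hl, inValence]
    refine (Set.ncard_le_one (l.finite_toSet.subset fun e he => he.1)).2 fun e he e' he' => ?_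
    have hnone : ∀ e ∈ l, e.tgt = some x → e.src = none := fun e he ht =>
      Option.eq_none_iff_forall_ne_some.2 fun v hv => (hne e he v).2 hv ht
    exact e.eq_of_src_eq_of_tgt_eq ((hnone e he.1 he.2).trans (hnone e' he'.1 he'.2).symm)
      (he.2.trans he'.2.symm)
  have hout : outCount l x ≤ 1 := by
    rw [← outValence_eq_outCount hl, outValence]
    refine (Set.ncard_le_one (l.finite_toSet.subset fun e he => he.1)).2 fun e he e' he' => ?_
    have hnone : ∀ e ∈ l, e.src = some x → e.tgt = none := fun e he hs =>
      Option.eq_none_iff_forall_ne_some.2 fun v hv => (hne e he v).1 hs hv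
    exact e.eq_of_src_eq_of_tgt_eq (he.2.trans he'.2.symm)
      ((hnone e he.1 he.2).trans (hnone e' he'.1 he'.2).symm)
  rw [IsSaturated] at h
  omega

/-- After splitting off `x`, the vertices are still anchored as soon as `x` is saturated: this
provides a vertex adjacent to `x`. -/
theorem IsAnchored.of_cut {I : W → Prop} {x : W} {S T : Finset (Option W)} {l l' l'' : List (Arc W)}
    (hl : IsIsolated l x) (hI : ∀ v, I v → v ≠ x → IsAnchored I l v)
    (hR : List.Forall₂ (fun e e' : Arc W => (e'.src = e.src ∨ e.src ∈ S ∧ e'.src = some x) ∧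
        (e'.tgt = e.tgt ∨ e.tgt ∈ T ∧ e'.tgt = some x)) l l')
    (hl'' : ∀ e ∈ l', e ∈ l'') (hnd : l''.Nodup) (hs : IsSaturated l'' x)
    (hST : ∀ u, some u ∈ S ∨ some u ∈ T → (innerSkeleton l'').Reachable u x) (v : W) :
    IsAnchored I l'' v := by
  have hne : ∀ v, v ≠ x → IsAnchored I l'' v := by
    intro v hvx
    by_cases hv : I v
    · refine (hI v hv hvx).induction (fun w hw => .of_not hw) fun e he u w hu hw => ?_
      obtain ⟨e', he', hs', ht'⟩ := exists_right_of_forall₂ hR he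
      have hu' : ∃ u', e'.src = some u' ∧ (innerSkeleton l'').Reachable u u' := by
        rcases hs' with h | ⟨hS, h⟩
        · exact ⟨u, h.trans hu, .refl u⟩
        · exact ⟨x, h, hST u (.inl (hu ▸ hS))⟩
      have hw' : ∃ w', e'.tgt = some w' ∧ (innerSkeleton l'').Reachable w w' := by
        rcases ht' with h | ⟨hT, h⟩
        · exact ⟨w, h.trans hw, .refl w⟩
        · exact ⟨x, h, hST w (.inr (hw ▸ hT))⟩
      obtain ⟨u', hu', hru⟩ := hu'
      obtain ⟨w', hw', hrw⟩ := hw'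
      exact IsAnchored.congr (hru.trans ((reachable_of_mem (hl'' e' he') hu' hw').trans hrw.symm))
    · exact .of_not hv
  by_cases hvx : v = x
  · subst hvx
    obtain ⟨e, he, w, ⟨h₁, h₂⟩ | ⟨h₁, h₂⟩⟩ := hs.exists_neighbour hnd
    · exact (hne w fun h => e.loopless v ⟨h₁, h ▸ h₂⟩).of_reachable (reachable_of_mem he h₁ h₂)
    · exact (hne w fun h => e.loopless v ⟨h ▸ h₁, h₂⟩).of_reachable (reachable_of_mem he h₁ h₂).symm
  · exact hne v hvx

theorem edge_mul_cut_mem {x : W} {S T : Finset (Option W)} {a b : Option W}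
    {P R : List (Arc W) → Prop} {Γ : Gra₁ W} (hΓ : Γ ∈ Gra₁.spanOf P)
    (h : ∀ (e : Arc W) (l l' : List (Arc W)), e.src = a → e.tgt = b → P l →
      List.Forall₂ (fun e e' : Arc W => (e'.src = e.src ∨ e.src ∈ S ∧ e'.src = some x) ∧
        (e'.tgt = e.tgt ∨ e.tgt ∈ T ∧ e'.tgt = some x)) l l' →
      (e :: l').Nodup → R (e :: l')) :
    edge a b * cut x S T Γ ∈ Gra₁.spanOf R := by
  refine mul_mem_monomialSpan
    (edge_mem_spanOf (P := fun l => ∃ e : Arc W, e.src = a ∧ e.tgt = b ∧ l = [e])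
      fun e hs ht => ⟨e, hs, ht, rfl⟩)
    (cut_mem_spanOf x S T hΓ) ?_
  rintro _ l' hnd ⟨e, hs, ht, rfl⟩ ⟨l, hP, hR⟩
  exact h e l l' hs ht hP hR hnd

theorem newVertex_mem [Fintype W] {c : W → ℝ} {x : W} {Γ : Gra₁ W} {N : Submodule ℝ (Gra₁ W)}
    (hout : ∀ a b, edge a b * cut x {none} ∅ Γ ∈ N) (hin : ∀ a b, edge a b * cut x ∅ {none} Γ ∈ N)
    (hv : ∀ v, c v • ((edge (some v) (some x) + edge (some x) (some v)) *
      cut x {some v} {some v} Γ) ∈ N) :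
    newVertex c x Γ ∈ N := by
  refine sub_mem (sub_mem ?_ ?_) (sum_mem fun v _ => hv v)
  · rw [sub_mul, Finset.sum_mul]
    exact sub_mem (sum_mem fun b _ => hout _ _) (hout _ _)
  · rw [sub_mul, Finset.sum_mul]
    exact sub_mem (hin _ _) (sum_mem fun b _ => hin _ _)

theorem newVertex_mem_length [Fintype W] {c : W → ℝ} {x : W} {n : ℤ} {Γ : Gra₁ W}
    (hΓ : Γ ∈ Gra₁.spanOf fun l => (l.length : ℤ) = n) :
    newVertex c x Γ ∈ Gra₁.spanOf fun l => (l.length : ℤ) = n + 1 := by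
  have h : ∀ a b S T, edge a b * cut x S T Γ ∈
      Gra₁.spanOf fun l => (l.length : ℤ) = n + 1 := fun a b S T =>
    edge_mul_cut_mem hΓ fun e l l' _ _ hl hR _ => by
      rw [List.length_cons, ← hR.length_eq, Nat.cast_succ, hl]
  exact newVertex_mem (fun a b => h _ _ _ _) (fun a b => h _ _ _ _) fun v => by
    rw [add_mul]; exact Submodule.smul_mem _ _ (add_mem (h _ _ _ _) (h _ _ _ _))

theorem newVertex_mem_anchored [Fintype W] {I : W → Prop} {c : W → ℝ} {x : W} {Γ : Gra₁ W}
    (hΓ : Γ ∈ Gra₁.spanOf fun l => IsIsolated l x ∧ ∀ v, I v → v ≠ x → IsAnchored I l v) :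
    newVertex c x Γ ∈ Gra₁.spanOf fun l => IsSaturated l x → ∀ v, IsAnchored I l v := by
  have h : ∀ a b S T, (∀ u, some u ∈ S ∨ some u ∈ T →
      a = some u ∧ b = some x ∨ a = some x ∧ b = some u) → edge a b * cut x S T Γ ∈
        Gra₁.spanOf fun l => IsSaturated l x → ∀ v, IsAnchored I l v := fun a b S T hST =>
    edge_mul_cut_mem hΓ fun e l l' ha hb hl hR hnd hs =>
      IsAnchored.of_cut hl.1 hl.2 hR (fun _ => List.mem_cons_of_mem _) hnd hs
        (fun u hu => by
          rcases hST u hu with ⟨rfl, rfl⟩ | ⟨rfl, rfl⟩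
          · exact reachable_of_mem List.mem_cons_self ha hb
          · exact (reachable_of_mem List.mem_cons_self ha hb).symm)
  refine newVertex_mem (fun a b => h _ _ _ _ (by simp)) (fun a b => h _ _ _ _ (by simp)) fun v => ?_
  rw [add_mul]
  exact Submodule.smul_mem _ _ (add_mem (h _ _ _ _ (by simp)) (h _ _ _ _ (by simp)))

/-! ### Cancellation of the graphs with an unsaturated vertex -/

/-- The combinations of graphs in which `y` is saturated; this is a two-sided ideal. -/
def saturatedSpan (y : W) : Submodule ℝ (Gra₁ W) := Gra₁.spanOf fun l => IsSaturated l y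

theorem mul_mem_saturatedSpan {y : W} (f : Gra₁ W) {g : Gra₁ W} (hg : g ∈ saturatedSpan y) :
    f * g ∈ saturatedSpan y :=
  mul_mem_monomialSpan (mem_monomialSpan_true f) hg fun _ _ _ _ h => h.append_left _

theorem mul_mem_saturatedSpan_right {y : W} {f : Gra₁ W} (hf : f ∈ saturatedSpan y) (g : Gra₁ W) :
    f * g ∈ saturatedSpan y :=
  mul_mem_monomialSpan hf (mem_monomialSpan_true g) fun _ _ _ h _ => h.append_right _

/-- Vertices other than the one that is split remain saturated. -/
theorem edge_mul_cut_mem_saturatedSpan {x y : W} {a b : Option W} {S T : Finset (Option W)}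
    (hS : some y ∉ S) (hT : some y ∉ T) {Γ : Gra₁ W} (hΓ : Γ ∈ saturatedSpan y) :
    edge a b * cut x S T Γ ∈ saturatedSpan y := by
  refine mul_mem_saturatedSpan _ (monomialSpan_mono ?_ (cut_mem_spanOf x S T hΓ))
  rintro l' - ⟨l, hl, hR⟩
  refine hl.of_forall₂ (fun e e' h => ⟨fun hs => ?_, fun ht => ?_⟩) hR
  · rcases h.1 with h | ⟨h, -⟩
    · rw [h, hs]
    · exact absurd (hs ▸ h) hS
  · rcases h.2 with h | ⟨h, -⟩
    · rw [h, ht]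
    · exact absurd (ht ▸ h) hT

/-- If `y` is saturated in `Γ`, then only the splitting of `y` contributes graphs in which it is
not. -/
theorem newVertex_add_mem_saturatedSpan [Fintype W] (c : W → ℝ) {x y : W} {Γ : Gra₁ W}
    (hΓ : Γ ∈ saturatedSpan y) :
    newVertex c x Γ + c y • ((edge (some y) (some x) + edge (some x) (some y)) *
      cut x {some y} {some y} Γ) ∈ saturatedSpan y := by
  classical
  have : newVertex c x Γ + c y • ((edge (some y) (some x) + edge (some x) (some y)) *
      cut x {some y} {some y} Γ) = newVertex (Function.update c y 0) x Γ := by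
    have hsum : ∀ g : W → Gra₁ W,
        ∑ v, c v • g v = ∑ v, Function.update c y 0 v • g v + c y • g y := fun g => by
      rw [← Finset.add_sum_erase _ _ (Finset.mem_univ y),
        ← Finset.add_sum_erase (Finset.univ : Finset W) (fun v => Function.update c y 0 v • g v)
          (Finset.mem_univ y), Function.update_self, zero_smul, zero_add, add_comm]
      exact congrArg (· + _) (Finset.sum_congr rfl fun v hv => by
        rw [Function.update_of_ne (Finset.ne_of_mem_erase hv)])
    simp only [newVertex]
    rw [hsum]
    abel
  rw [this]
  refine newVertex_mem (fun a b => edge_mul_cut_mem_saturatedSpan (by simp) (by simp) hΓ)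
    (fun a b => edge_mul_cut_mem_saturatedSpan (by simp) (by simp) hΓ) fun v => ?_
  by_cases hv : v = y
  · rw [hv, Function.update_self, zero_smul]; exact zero_mem _
  · have hv' : some y ∉ ({some v} : Finset (Option W)) := by simpa using Ne.symm hv
    rw [add_mul]
    exact Submodule.smul_mem _ _ (add_mem (edge_mul_cut_mem_saturatedSpan hv' hv' hΓ)
      (edge_mul_cut_mem_saturatedSpan hv' hv' hΓ))

/-- Two edges out of `x`, or two edges into `x`, saturate `x`. -/
theorem edge_mul_edge_mem_saturatedSpan {x : W} {a b a' b' : Option W}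
    (h : a = some x ∧ a' = some x ∨ b = some x ∧ b' = some x) (g : Gra₁ W) :
    edge a b * (edge a' b' * g) ∈ saturatedSpan x := by
  rw [← mul_assoc]
  refine mul_mem_saturatedSpan_right (mul_mem_monomialSpan
    (edge_mem_spanOf (P := fun l => ∃ e : Arc W, e.src = a ∧ e.tgt = b ∧ l = [e])
      fun e hs ht => ⟨e, hs, ht, rfl⟩)
    (edge_mem_spanOf (P := fun l => ∃ e : Arc W, e.src = a' ∧ e.tgt = b' ∧ l = [e])
      fun e hs ht => ⟨e, hs, ht, rfl⟩) ?_) g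
  rintro _ _ - ⟨e, rfl, rfl, rfl⟩ ⟨e', rfl, rfl, rfl⟩
  rcases h with ⟨h, h'⟩ | ⟨h, h'⟩
  · exact .inr (by simp [outCount, h, h'])
  · exact .inl (by simp [inCount, h, h'])

/-- The combinations of graphs in which `x` is not isolated; this is a two-sided ideal. -/
def touchingSpan (x : W) : Submodule ℝ (Gra₁ W) := Gra₁.spanOf fun l => ¬ IsIsolated l x

/-- The only term of `cut` that leaves `x` isolated is the one in which no edge is reconnected. -/
theorem cut_sub_self_mem {x : W} {S T : Finset (Option W)} {l : List (Arc W)}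
    (hl : IsIsolated l x) : cut x S T (monomial l) - monomial l ∈ touchingSpan x := by
  classical
  induction l with
  | nil => simp
  | cons e l ih =>
    have he := hl e List.mem_cons_self
    have ih := ih fun e' he' => hl e' (List.mem_cons_of_mem _ he')
    have h : ∀ a b : Option W, a = some x ∨ b = some x → ∀ g : Gra₁ W,
        edge a b * g ∈ touchingSpan x := fun a b hab g => by
      refine mul_mem_monomialSpan (edge_mem_spanOf
        (P := fun l => ¬ IsIsolated l x) fun e hs ht => ?_) (mem_monomialSpan_true g) ?_
      · intro hi
        have := hi e List.mem_cons_self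
        rcases hab with rfl | rfl
        · exact this.1 hs
        · exact this.2 ht
      · exact fun l l' _ hl _ hi => hl fun e he => hi e (List.mem_append_left _ he)
    have h' : edge e.src e.tgt * (cut x S T (monomial l) - monomial l) ∈ touchingSpan x :=
      mul_mem_monomialSpan (mem_monomialSpan_true _) ih
        fun l l' _ _ hl hi => hl fun e he => hi e (List.mem_append_right _ he)
    have key : cut x S T (monomial (e :: l)) - monomial (e :: l) =
        edge e.src e.tgt * (cut x S T (monomial l) - monomial l) +
        ((if e.src ∈ S then edge (some x) e.tgt * cut x S T (monomial l) else 0) +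
          if e.tgt ∈ T then edge e.src (some x) * cut x S T (monomial l) else 0) := by
      rw [monomial_cons, ι_single, map_mul, cut_edge_of_ne S T e.loopless he.1 he.2]
      split_ifs <;> noncomm_ring
    rw [key]
    refine add_mem h' (add_mem ?_ ?_)
    · split_ifs
      · exact h _ _ (.inl rfl) _
      · exact zero_mem _
    · split_ifs
      · exact h _ _ (.inr rfl) _
      · exact zero_mem _

end Differential

section Cancellation

variable {V W : Type}

/-- An edge into `x` and an edge out of `x` saturate `x` as soon as there is a third edge at `x`. -/
theorem edge_mul_edge_mul_mem {x : W} {a b : Option W} {g : Gra₁ W} (hg : g ∈ touchingSpan x) :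
    edge a (some x) * (edge (some x) b * g) ∈ saturatedSpan x := by
  rw [← mul_assoc]
  refine mul_mem_monomialSpan (mul_mem_monomialSpan
    (edge_mem_spanOf (P := fun l => ∃ e : Arc W, e.tgt = some x ∧ l = [e])
      fun e hs ht => ⟨e, ht, rfl⟩)
    (edge_mem_spanOf (P := fun l => ∃ e : Arc W, e.src = some x ∧ l = [e])
      fun e hs ht => ⟨e, hs, rfl⟩) (R := fun l => 1 ≤ inCount l x ∧ 1 ≤ outCount l x) ?_) hg ?_
  · rintro _ _ - ⟨e, h, rfl⟩ ⟨e', h', rfl⟩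
    simp [inCount, outCount, List.countP_cons, h, h']
  · rintro l l' - ⟨h₁, h₂⟩ hl'
    have : 1 ≤ inCount l' x ∨ 1 ≤ outCount l' x := by
      simp only [inCount, outCount, Nat.one_le_iff_ne_zero, ← Nat.pos_iff_ne_zero,
        List.countP_pos_iff, decide_eq_true_eq]
      by_contra! hne
      exact hl' fun e he => ⟨hne.2 e he, hne.1 e he⟩
    rw [IsSaturated, inCount_append, outCount_append]
    omega

open Classical in
/-- The terms of the differential in which the first edge, from `a` to `b`, is made to start at `x`:
they come from the reconnection of the edges at `out` if `a = none` and from the splitting of `v` if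
`a = some v`.  In both cases they are `-(a → x)(x → b) Γ` modulo graphs in which `x` is
saturated. -/
theorem src_terms_mem [Fintype W] {x : W} {l : List (Arc W)} (hl : IsIsolated l x)
    (a b : Option W) :
    (if a = none then ((∑ b', edge (some x) b') - edge none (some x)) *
        (edge (some x) b * cut x {none} ∅ (monomial l)) else 0)
      - (∑ v, if a = some v then (edge (some v) (some x) + edge (some x) (some v)) *
        (edge (some x) b * cut x {some v} {some v} (monomial l)) else 0)
      + edge a (some x) * (edge (some x) b * monomial l) ∈ saturatedSpan x := by
  rcases a with _ | v
  · have h₁ : (∑ b', edge (some x) b') * (edge (some x) b * cut x {none} ∅ (monomial l)) ∈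
        saturatedSpan x := by
      rw [Finset.sum_mul]
      exact sum_mem fun b' _ => edge_mul_edge_mem_saturatedSpan (.inl ⟨rfl, rfl⟩) _
    have h₂ := edge_mul_edge_mul_mem (a := none) (b := b)
      (cut_sub_self_mem (S := {none}) (T := ∅) hl)
    convert sub_mem h₁ h₂ using 1
    simp only [if_true, reduceCtorEq, if_false, Finset.sum_const_zero]
    noncomm_ring
  · have h₁ := edge_mul_edge_mem_saturatedSpan (x := x) (a := some x) (b := some v) (a' := some x)
      (b' := b) (.inl ⟨rfl, rfl⟩) (cut x {some v} {some v} (monomial l))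
    have h₂ := edge_mul_edge_mul_mem (a := some v) (b := b)
      (cut_sub_self_mem (S := {some v}) (T := {some v}) hl)
    convert neg_mem (add_mem h₁ h₂) using 1
    simp only [reduceCtorEq, if_false, Option.some.injEq, Finset.sum_ite_eq, Finset.mem_univ,
      if_true]
    noncomm_ring

open Classical in
/-- The terms of the differential in which the first edge, from `a` to `b`, is made to end at `x`:
they are `-(x → b)(a → x) Γ` modulo graphs in which `x` is saturated. -/
theorem tgt_terms_mem [Fintype W] {x : W} {l : List (Arc W)} (hl : IsIsolated l x)
    (a b : Option W) :
    -(if b = none then (edge (some x) none - ∑ a', edge a' (some x)) *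
        (edge a (some x) * cut x ∅ {none} (monomial l)) else 0)
      - (∑ v, if b = some v then (edge (some v) (some x) + edge (some x) (some v)) *
        (edge a (some x) * cut x {some v} {some v} (monomial l)) else 0)
      + edge (some x) b * (edge a (some x) * monomial l) ∈ saturatedSpan x := by
  rcases b with _ | v
  · have h₁ : (∑ a', edge a' (some x)) * (edge a (some x) * cut x ∅ {none} (monomial l)) ∈
        saturatedSpan x := by
      rw [Finset.sum_mul]
      exact sum_mem fun b' _ => edge_mul_edge_mem_saturatedSpan (.inr ⟨rfl, rfl⟩) _
    have h₂ := edge_mul_edge_mul_mem (a := a) (b := none)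
      (cut_sub_self_mem (S := ∅) (T := {none}) hl)
    convert add_mem h₁ h₂ using 1
    simp only [if_true, reduceCtorEq, if_false, Finset.sum_const_zero, sub_mul, mul_sub,
      edge_mul_edge_mul (some x) none a (some x)]
    abel
  · have h₁ := edge_mul_edge_mem_saturatedSpan (x := x) (a := some v) (b := some x) (a' := a)
      (b' := some x) (.inr ⟨rfl, rfl⟩) (cut x {some v} {some v} (monomial l))
    have h₂ := edge_mul_edge_mul_mem (a := a) (b := some v)
      (cut_sub_self_mem (S := {some v}) (T := {some v}) hl)
    convert sub_mem h₂ h₁ using 1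
    simp only [reduceCtorEq, if_false, Option.some.injEq, Finset.sum_ite_eq, Finset.mem_univ,
      if_true, add_mul, mul_sub, edge_mul_edge_mul (some x) (some v) a (some x)]
    abel

/-- If all vertices are split with the coefficient `1`, then the graphs in which the new vertex `x`
is univalent, or bivalent with one incoming and one outgoing edge, cancel. -/
theorem newVertex_one_mem_saturatedSpan [Fintype W] {x : W} {Γ : Gra₁ W}
    (hΓ : Γ ∈ Gra₁.spanOf fun l => IsIsolated l x) :
    newVertex (fun _ => 1) x Γ ∈ saturatedSpan x := by
  classical
  have hmon : ∀ l : List (Arc W), IsIsolated l x →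
      newVertex (fun _ => 1) x (monomial l) ∈ saturatedSpan x := by
    intro l hl
    induction l with
    | nil =>
      have : newVertex (fun _ => 1) x (monomial ([] : List (Arc W))) = 0 := by
        simp only [newVertex, monomial_nil, map_one, mul_one, one_smul, Fintype.sum_option,
          Finset.sum_add_distrib]
        abel
      rw [this]
      exact zero_mem _
    | cons e l ih =>
      have he := hl e List.mem_cons_self
      have hl' : IsIsolated l x := fun e' he' => hl e' (List.mem_cons_of_mem _ he')
      have hcut : ∀ S T, cut x S T (monomial (e :: l)) =
          (edge e.src e.tgt + (if e.src ∈ S then edge (some x) e.tgt else 0) +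
            if e.tgt ∈ T then edge e.src (some x) else 0) * cut x S T (monomial l) := fun S T => by
        rw [monomial_cons, ι_single, map_mul, cut_edge_of_ne S T e.loopless he.1 he.2]
      have hout : ((∑ b, edge (some x) b) - edge none (some x)) *
          cut x {none} ∅ (monomial (e :: l)) =
          -(edge e.src e.tgt * (((∑ b, edge (some x) b) - edge none (some x)) *
            cut x {none} ∅ (monomial l))) +
          if e.src = none then ((∑ b', edge (some x) b') - edge none (some x)) *
            (edge (some x) e.tgt * cut x {none} ∅ (monomial l)) else 0 := by
        rw [hcut]
        simp only [Finset.mem_singleton, Finset.notMem_empty, if_false, add_zero, add_mul, mul_add,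
          ite_mul, zero_mul, mul_ite, mul_zero, sub_mul, mul_sub, Finset.sum_mul, Finset.mul_sum,
          edge_mul_edge_mul e.src e.tgt, Finset.sum_neg_distrib]
        abel
      have hin : (edge (some x) none - ∑ a, edge a (some x)) *
          cut x ∅ {none} (monomial (e :: l)) =
          -(edge e.src e.tgt * ((edge (some x) none - ∑ a, edge a (some x)) *
            cut x ∅ {none} (monomial l))) +
          if e.tgt = none then (edge (some x) none - ∑ a', edge a' (some x)) *
            (edge e.src (some x) * cut x ∅ {none} (monomial l)) else 0 := by
        rw [hcut]
        simp only [Finset.mem_singleton, Finset.notMem_empty, if_false, add_zero, add_mul, mul_add,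
          ite_mul, zero_mul, mul_ite, mul_zero, sub_mul, mul_sub, Finset.sum_mul, Finset.mul_sum,
          edge_mul_edge_mul e.src e.tgt, Finset.sum_neg_distrib]
        abel
      have hv : ∀ v, (edge (some v) (some x) + edge (some x) (some v)) *
          cut x {some v} {some v} (monomial (e :: l)) =
          -(edge e.src e.tgt * ((edge (some v) (some x) + edge (some x) (some v)) *
            cut x {some v} {some v} (monomial l))) +
          (if e.src = some v then (edge (some v) (some x) + edge (some x) (some v)) *
            (edge (some x) e.tgt * cut x {some v} {some v} (monomial l)) else 0) +
          if e.tgt = some v then (edge (some v) (some x) + edge (some x) (some v)) *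
            (edge e.src (some x) * cut x {some v} {some v} (monomial l)) else 0 := fun v => by
        rw [hcut]
        simp only [Finset.mem_singleton, add_mul, mul_add,
          ite_mul, zero_mul, mul_ite, mul_zero, edge_mul_edge_mul e.src e.tgt]
        abel
      -- The new vertex is odd, so it anticommutes with `e`, and the correction terms, in which `e`
      -- itself is split by `x`, cancel since the two halves of `e` anticommute.
      convert add_mem (add_mem (neg_mem (mul_mem_saturatedSpan (edge e.src e.tgt) (ih hl')))
        (src_terms_mem hl' e.src e.tgt)) (tgt_terms_mem hl' e.src e.tgt) using 1
      simp only [newVertex, hout, hin, hv, one_smul, Finset.sum_add_distrib, Finset.sum_neg_distrib,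
        mul_sub, ← Finset.mul_sum, edge_mul_edge_mul (some x) e.tgt e.src (some x)]
      abel
  have hle : (Gra₁.spanOf fun l => IsIsolated l x) ≤
      (saturatedSpan x).comap ((newVertex_isLinearMap (fun _ => 1) x).mk' _) :=
    monomialSpan_le fun l _ hl => hmon l hl
  exact hle hΓ

end Cancellation

/-! ### Equivariance -/

section Equivariance

variable {U U' V V' W B B' : Type}

theorem exists_perm_comp {X Y : Type*} {p q : X → Y} (hp : p.Injective) (hq : q.Injective)
    (h : Set.range p = Set.range q) : ∃ ρ : Equiv.Perm X, p = q ∘ ρ := by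
  refine ⟨(Equiv.ofInjective p hp).trans ((Equiv.setCongr h).trans (Equiv.ofInjective q hq).symm),
    funext fun x => ?_⟩
  simp [Equiv.apply_ofInjective_symm]

theorem sumCongr_refl_eq {A X : Type*} (σ : Equiv.Perm X) :
    ⇑((Equiv.refl A).sumCongr σ) = Sum.map id σ := rfl

theorem relabel_comp [Fintype U] [Fintype U'] [Fintype V] [Fintype V'] (φ : U ≃ U') (ψ : V ≃ V')
    (Γ : Gra₁ U) (Γ' : Gra₁ V) :
    Gra₁.relabel (Sum.map φ ψ) (Gra₁.comp Γ Γ') =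
      Gra₁.comp (Gra₁.relabel φ Γ) (Gra₁.relabel ψ Γ') := by
  rw [Gra₁.comp, map_mul, Gra₁.comp]
  congr 1
  · rw [relabel_reconnect _ _ _ _ (F := (reconnect _ _).comp (Gra₁.relabel φ)), AlgHom.comp_apply]
    intro a b h
    rw [AlgHom.comp_apply, relabel_edge, reconnect_edge _ _ (map_noLoop φ.injective h)]
    rcases b with _ | b
    · simp only [Finset.sum_singleton, Option.map_none, Finset.sum_map]
      refine (Fintype.sum_equiv (Equiv.optionCongr ψ) _ _ fun b => ?_).symm
      rcases a with _ | a <;> rcases b with _ | b <;> simp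
    · rcases a with _ | a <;> simp
  · rw [relabel_reconnect _ _ _ _ (F := (reconnect _ _).comp (Gra₁.relabel ψ)), AlgHom.comp_apply]
    intro a b h
    rw [AlgHom.comp_apply, relabel_edge, reconnect_edge _ _ (map_noLoop ψ.injective h)]
    rcases a with _ | a
    · simp only [Finset.sum_singleton, Option.map_none, Finset.sum_map]
      refine (Fintype.sum_equiv (Equiv.optionCongr φ) _ _ fun a => ?_).symm
      rcases a with _ | a <;> rcases b with _ | b <;> simp
    · rcases b with _ | b <;> simp

theorem relabel_insert [DecidableEq V] [DecidableEq V'] [Fintype B] [Fintype B'] {φ : V → V'}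
    (hφ : φ.Injective) (ψ : B ≃ B') (v : V) (v' : V') (hv : φ v = v')
    (r : {u : V // u ≠ v} → {u : V' // u ≠ v'}) (hr : ∀ u, (r u : V') = φ u) (Γ : Gra₁ V)
    (γ : Gra B) :
    Gra₁.relabel (Sum.map r ψ) (Gra₁.insert v Γ γ) =
      Gra₁.insert v' (Gra₁.relabel φ Γ) (Gra.relabel ψ.toEmbedding γ) := by
  subst hv
  rw [insert_eq, map_mul, insert_eq, relabel_orient, orient_relabel]
  congr 1
  have hsum : ∀ (a : Option V)
      (f : Option ({u : V' // u ≠ φ v} ⊕ B') → Gra₁ ({u : V' // u ≠ φ v} ⊕ B')),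
      ∑ a' ∈ insertSpread (φ v) (a.map φ), f a' =
        ∑ a' ∈ insertSpread v a, f (a'.map (Sum.map r ψ)) := by
    rintro (_ | u) f
    · simp
    · by_cases hu : u = v
      · subst hu
        simp only [Option.map_some, insertSpread_self, Finset.sum_map]
        exact (Fintype.sum_equiv ψ _ _ fun b => rfl).symm
      · have hu' : φ u ≠ φ v := fun h => hu (hφ h)
        have : r ⟨u, hu⟩ = ⟨φ u, hu'⟩ := Subtype.ext (hr _)
        simp [insertSpread_of_ne hu, insertSpread_of_ne hu', this]
  rw [relabel_reconnect _ _ _ _ (F := (reconnect _ _).comp (Gra₁.relabel φ)), AlgHom.comp_apply]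
  intro a b h
  rw [AlgHom.comp_apply, relabel_edge, reconnect_edge _ _ (map_noLoop hφ h), hsum a]
  exact Finset.sum_congr rfl fun a' _ => hsum b _

/-- An invariant element, placed on internal vertices by means of an injection, depends only on the
set of these vertices. -/
theorem relabel_congr_of_range {A : Type} {k m : ℕ} {Γ : Gra₁ (A ⊕ Fin k)}
    (hΓ : ∀ σ : Equiv.Perm (Fin k), Gra₁.relabel (Sum.map id σ) Γ = Γ) {p q : Fin k → Fin m}
    (hp : p.Injective) (hq : q.Injective) (h : Set.range p = Set.range q) :
    Gra₁.relabel (Sum.map id p) Γ = Gra₁.relabel (Sum.map id q) Γ := by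
  obtain ⟨ρ, rfl⟩ := exists_perm_comp hp hq h
  conv_rhs => rw [← hΓ ρ]
  rw [relabel_relabel, Sum.map_comp_map, Function.id_comp]

theorem eq_of_range_eq {n n' k : ℕ} {p : Fin n → Fin k} {p' : Fin n' → Fin k} (hp : p.Injective)
    (hp' : p'.Injective) (h : Set.range p = Set.range p') : n = n' := by
  have h₁ := Set.card_range_of_injective hp
  have h₂ := Set.card_range_of_injective hp'
  rw [Fintype.card_fin] at h₁ h₂
  rw [← h₁, ← h₂]
  exact Fintype.card_congr (Equiv.setCongr h)

/-- The summand of the moperadic composition for the distribution of the internal vertices that is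
given by `p` and `q`. -/
def compTerm {A B : Type} [Fintype A] [Fintype B] (f : PreTw₁ A) (g : PreTw₁ B) {n m k : ℕ}
    (p : Fin n → Fin k) (q : Fin m → Fin k) : Gra₁ ((A ⊕ B) ⊕ Fin k) :=
  Gra₁.relabel (Sum.elim (Sum.map Sum.inl p) (Sum.map Sum.inr q)) (Gra₁.comp (f n) (g m))

theorem compTerm_congr {A B : Type} [Fintype A] [Fintype B] {f : PreTw₁ A} {g : PreTw₁ B}
    (hf : ∀ k (σ : Equiv.Perm (Fin k)), Gra₁.relabel (Sum.map id σ) (f k) = f k)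
    (hg : ∀ k (σ : Equiv.Perm (Fin k)), Gra₁.relabel (Sum.map id σ) (g k) = g k)
    {n n' m m' k : ℕ} {p : Fin n → Fin k} {p' : Fin n' → Fin k} {q : Fin m → Fin k}
    {q' : Fin m' → Fin k} (hp : p.Injective) (hp' : p'.Injective) (hq : q.Injective)
    (hq' : q'.Injective) (hpp' : Set.range p = Set.range p') (hqq' : Set.range q = Set.range q') :
    compTerm f g p q = compTerm f g p' q' := by
  obtain rfl := eq_of_range_eq hp hp' hpp'
  obtain rfl := eq_of_range_eq hq hq' hqq'
  obtain ⟨ρ, rfl⟩ := exists_perm_comp hp hp' hpp'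
  obtain ⟨τ, rfl⟩ := exists_perm_comp hq hq' hqq'
  have := relabel_comp ((Equiv.refl A).sumCongr ρ) ((Equiv.refl B).sumCongr τ) (f n) (g m)
  rw [sumCongr_refl_eq, sumCongr_refl_eq, hf, hg] at this
  rw [compTerm, compTerm]
  conv_rhs => rw [← this]
  rw [relabel_relabel]
  congr 2
  ext ((a | i) | (b | j)) <;> rfl

theorem relabel_compTerm {A B : Type} [Fintype A] [Fintype B] (f : PreTw₁ A) (g : PreTw₁ B)
    {n m k : ℕ} (p : Fin n → Fin k) (q : Fin m → Fin k) (σ : Fin k → Fin k) :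
    Gra₁.relabel (Sum.map id σ) (compTerm f g p q) = compTerm f g (σ ∘ p) (σ ∘ q) := by
  rw [compTerm, relabel_relabel, compTerm]
  congr 2
  ext ((a | i) | (b | j)) <;> rfl

theorem range_comp_orderEmbOfFin {k : ℕ} (σ : Equiv.Perm (Fin k)) (S : Finset (Fin k)) :
    Set.range (σ ∘ S.orderEmbOfFin rfl) = Set.range ((S.map σ.toEmbedding).orderEmbOfFin rfl) := by
  rw [Set.range_comp, Finset.range_orderEmbOfFin, Finset.range_orderEmbOfFin, Finset.coe_map]
  rfl

theorem range_comp_orderEmbOfFin_compl {k : ℕ} (σ : Equiv.Perm (Fin k)) (S : Finset (Fin k)) :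
    Set.range (σ ∘ Sᶜ.orderEmbOfFin rfl) =
      Set.range ((S.map σ.toEmbedding)ᶜ.orderEmbOfFin rfl) := by
  rw [Set.range_comp, Finset.range_orderEmbOfFin, Finset.range_orderEmbOfFin, Finset.coe_compl,
    Finset.coe_compl, Finset.coe_map, Set.image_compl_eq σ.bijective]
  rfl

theorem relabel_twComp {A B : Type} [Fintype A] [Fintype B] {f : PreTw₁ A} {g : PreTw₁ B}
    (hf : ∀ k (σ : Equiv.Perm (Fin k)), Gra₁.relabel (Sum.map id σ) (f k) = f k)
    (hg : ∀ k (σ : Equiv.Perm (Fin k)), Gra₁.relabel (Sum.map id σ) (g k) = g k)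
    (k : ℕ) (σ : Equiv.Perm (Fin k)) :
    Gra₁.relabel (Sum.map id σ) (twComp f g k) = twComp f g k := by
  rw [twComp, map_sum]
  refine Fintype.sum_equiv σ.finsetCongr _ _ fun S => ?_
  refine (relabel_compTerm f g _ _ σ).trans (compTerm_congr hf hg ?_ ?_ ?_ ?_ ?_ ?_)
  · exact σ.injective.comp (S.orderEmbOfFin rfl).injective
  · exact ((S.map σ.toEmbedding).orderEmbOfFin rfl).injective
  · exact σ.injective.comp (Sᶜ.orderEmbOfFin rfl).injective
  · exact ((S.map σ.toEmbedding)ᶜ.orderEmbOfFin rfl).injective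
  · exact range_comp_orderEmbOfFin σ S
  · exact range_comp_orderEmbOfFin_compl σ S

/-- The vertices of an insertion at the external vertex `a`, when the internal vertices are
distributed by means of `p` and `q`. -/
def insertPlace {A B : Type} (a : A) {n m k : ℕ} (p : Fin n → Fin k) (q : Fin m → Fin k) :
    {u : A ⊕ Fin n // u ≠ Sum.inl a} ⊕ (B ⊕ Fin m) → ({x : A // x ≠ a} ⊕ B) ⊕ Fin k :=
  Sum.elim
    (fun u =>
      match u with
      | ⟨Sum.inl x, h⟩ => Sum.inl (Sum.inl ⟨x, fun hx => h (congrArg Sum.inl hx)⟩)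
      | ⟨Sum.inr i, _⟩ => Sum.inr (p i))
    (Sum.map Sum.inr q)

/-- The summand of the insertion for the distribution of the internal vertices that is given by `p`
and `q`. -/
def insertTerm {A B : Type} [DecidableEq A] [Fintype B] (a : A) (f : PreTw₁ A) (g : PreTw B)
    {n m k : ℕ} (p : Fin n → Fin k) (q : Fin m → Fin k) :
    Gra₁ (({x : A // x ≠ a} ⊕ B) ⊕ Fin k) :=
  Gra₁.relabel (insertPlace a p q) (Gra₁.insert (Sum.inl a) (f n) (g m))

theorem twInsert_eq_sum {A B : Type} [DecidableEq A] [Fintype B] (a : A) (f : PreTw₁ A)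
    (g : PreTw B) (k : ℕ) :
    twInsert a f g k =
      ∑ S : Finset (Fin k), insertTerm a f g (S.orderEmbOfFin rfl) (Sᶜ.orderEmbOfFin rfl) := by
  refine Finset.sum_congr rfl fun S _ => ?_
  rw [insertTerm]
  congr 2
  ext (⟨a | i, _⟩ | (b | j)) <;> rfl

theorem insertTerm_congr {A B : Type} [DecidableEq A] [Fintype B] (a : A) {f : PreTw₁ A}
    {g : PreTw B}
    (hf : ∀ k (σ : Equiv.Perm (Fin k)), Gra₁.relabel (Sum.map id σ) (f k) = f k)
    (hg : ∀ k (σ : Equiv.Perm (Fin k)),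
      Gra.relabel ((Equiv.refl B).sumCongr σ).toEmbedding (g k) = g k)
    {n n' m m' k : ℕ} {p : Fin n → Fin k} {p' : Fin n' → Fin k} {q : Fin m → Fin k}
    {q' : Fin m' → Fin k} (hp : p.Injective) (hp' : p'.Injective) (hq : q.Injective)
    (hq' : q'.Injective) (hpp' : Set.range p = Set.range p') (hqq' : Set.range q = Set.range q') :
    insertTerm a f g p q = insertTerm a f g p' q' := by
  obtain rfl := eq_of_range_eq hp hp' hpp'
  obtain rfl := eq_of_range_eq hq hq' hqq'
  obtain ⟨ρ, rfl⟩ := exists_perm_comp hp hp' hpp'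
  obtain ⟨τ, rfl⟩ := exists_perm_comp hq hq' hqq'
  have hinj : (Sum.map id ρ : A ⊕ Fin n → A ⊕ Fin n).Injective :=
    Sum.map_injective.2 ⟨Function.injective_id, ρ.injective⟩
  have := relabel_insert hinj ((Equiv.refl B).sumCongr τ) (Sum.inl a) (Sum.inl a) rfl
    (fun u => ⟨Sum.map id ρ u, fun h => u.2 (hinj h)⟩) (fun _ => rfl) (f n) (g m)
  rw [hf, hg] at this
  rw [insertTerm, insertTerm]
  conv_rhs => rw [← this]
  rw [relabel_relabel]
  congr 2
  ext (⟨a | i, _⟩ | (b | j)) <;> rfl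

theorem relabel_insertTerm {A B : Type} [DecidableEq A] [Fintype B] (a : A) (f : PreTw₁ A)
    (g : PreTw B) {n m k : ℕ} (p : Fin n → Fin k) (q : Fin m → Fin k) (σ : Fin k → Fin k) :
    Gra₁.relabel (Sum.map id σ) (insertTerm a f g p q) = insertTerm a f g (σ ∘ p) (σ ∘ q) := by
  rw [insertTerm, relabel_relabel, insertTerm]
  congr 2
  ext (⟨a | i, _⟩ | (b | j)) <;> rfl

theorem relabel_twInsert {A B : Type} [DecidableEq A] [Fintype B] (a : A) {f : PreTw₁ A}
    {g : PreTw B}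
    (hf : ∀ k (σ : Equiv.Perm (Fin k)), Gra₁.relabel (Sum.map id σ) (f k) = f k)
    (hg : ∀ k (σ : Equiv.Perm (Fin k)),
      Gra.relabel ((Equiv.refl B).sumCongr σ).toEmbedding (g k) = g k)
    (k : ℕ) (σ : Equiv.Perm (Fin k)) :
    Gra₁.relabel (Sum.map id σ) (twInsert a f g k) = twInsert a f g k := by
  rw [twInsert_eq_sum, map_sum]
  refine Fintype.sum_equiv σ.finsetCongr _ _ fun S => ?_
  refine (relabel_insertTerm a f g _ _ σ).trans (insertTerm_congr a hf hg ?_ ?_ ?_ ?_ ?_ ?_)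
  · exact σ.injective.comp (S.orderEmbOfFin rfl).injective
  · exact ((S.map σ.toEmbedding).orderEmbOfFin rfl).injective
  · exact σ.injective.comp (Sᶜ.orderEmbOfFin rfl).injective
  · exact ((S.map σ.toEmbedding)ᶜ.orderEmbOfFin rfl).injective
  · exact range_comp_orderEmbOfFin σ S
  · exact range_comp_orderEmbOfFin_compl σ S

/-- The coefficients with which the differential splits external and internal vertices. -/
def splitCoeff {A : Type} {k : ℕ} : A ⊕ Fin k → ℝ := Sum.elim (fun _ => 1) fun _ => 1 / 2

theorem twDiff_succ {A : Type} [Fintype A] [DecidableEq A] (f : PreTw₁ A) (k : ℕ) :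
    twDiff f (k + 1) = ∑ x : Fin (k + 1), newVertex splitCoeff (Sum.inr x)
      (Gra₁.relabel (Sum.map id x.succAbove) (f k)) :=
  Finset.sum_congr rfl fun x _ => diffAt_eq x (f k)

theorem range_comp_succAbove {k : ℕ} (σ : Equiv.Perm (Fin (k + 1))) (x : Fin (k + 1)) :
    Set.range (σ ∘ x.succAbove) = Set.range (σ x).succAbove := by
  rw [Set.range_comp, Fin.range_succAbove, Fin.range_succAbove, Set.image_compl_eq σ.bijective,
    Set.image_singleton]

theorem relabel_relabel_succAbove {A : Type} {k : ℕ} {Γ : Gra₁ (A ⊕ Fin k)}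
    (hΓ : ∀ σ : Equiv.Perm (Fin k), Gra₁.relabel (Sum.map id σ) Γ = Γ)
    (σ : Equiv.Perm (Fin (k + 1))) (x : Fin (k + 1)) :
    Gra₁.relabel (Sum.map id σ) (Gra₁.relabel (Sum.map id x.succAbove) Γ) =
      Gra₁.relabel (Sum.map id (σ x).succAbove) Γ := by
  rw [relabel_relabel, Sum.map_comp_map, Function.id_comp]
  exact relabel_congr_of_range hΓ (σ.injective.comp Fin.succAbove_right_injective)
    Fin.succAbove_right_injective (range_comp_succAbove σ x)

theorem relabel_twDiff {A : Type} [Fintype A] [DecidableEq A] {f : PreTw₁ A}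
    (hf : ∀ k (σ : Equiv.Perm (Fin k)), Gra₁.relabel (Sum.map id σ) (f k) = f k)
    (k : ℕ) (σ : Equiv.Perm (Fin k)) :
    Gra₁.relabel (Sum.map id σ) (twDiff f k) = twDiff f k := by
  cases k with
  | zero => exact map_zero _
  | succ k =>
    rw [twDiff_succ, map_sum]
    refine Fintype.sum_equiv σ _ _ fun x => ?_
    have := relabel_newVertex (c := splitCoeff) ((Equiv.refl A).sumCongr σ)
      (by rintro (a | i) <;> rfl) (Sum.inr x) (Gra₁.relabel (Sum.map id x.succAbove) (f k))
    rw [sumCongr_refl_eq, relabel_relabel_succAbove (hf k)] at this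
    exact this

end Equivariance

/-! ### The differential of invariant combinations of graphs -/

section TwDiff

variable {A : Type} {k : ℕ}

theorem newVertex_eq_one_add [Fintype A] (y : Fin (k + 1)) (Γ : Gra₁ (A ⊕ Fin (k + 1))) :
    newVertex splitCoeff (Sum.inr y) Γ = newVertex (fun _ => 1) (Sum.inr y) Γ +
      ∑ x : Fin (k + 1), (1 / 2 : ℝ) •
        ((edge (some (Sum.inr x)) (some (Sum.inr y)) + edge (some (Sum.inr y)) (some (Sum.inr x))) *
          cut (Sum.inr y) {some (Sum.inr x)} {some (Sum.inr x)} Γ) := by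
  simp only [newVertex, Fintype.sum_sum_type, splitCoeff, Sum.elim_inl, Sum.elim_inr, one_smul]
  rw [← Finset.smul_sum]
  module

theorem sum_mem_of_add_mem {X M : Type*} [Fintype X] [AddCommGroup M] [Module ℝ M]
    {N : Submodule ℝ M} {F E : X → M} {y : X} {g : M} (hg : g ∈ N) (hy : F y = g + ∑ x, E x)
    (hE : E y = 0) (h : ∀ x, x ≠ y → F x + E x ∈ N) : ∑ x, F x ∈ N := by
  classical
  have := add_mem hg (sum_mem fun x hx => h x (Finset.ne_of_mem_erase hx) :
    ∑ x ∈ Finset.univ.erase y, (F x + E x) ∈ N)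
  rw [← Finset.add_sum_erase _ _ (Finset.mem_univ y), hy,
    ← Finset.add_sum_erase _ E (Finset.mem_univ y), hE, zero_add]
  rw [Finset.sum_add_distrib] at this
  convert this using 1
  abel

variable {Γ : Gra₁ (A ⊕ Fin k)}

/-- Relabelling by `Fin.succAbove x` makes room for the new internal vertex `x`; all other internal
vertices remain saturated and anchored. -/
theorem relabel_succAbove_mem (x : Fin (k + 1))
    (hΓ : Γ ∈ Gra₁.spanOf fun l => IsGood (fun v => v.isRight = true) l) :
    Gra₁.relabel (Sum.map id x.succAbove) Γ ∈ Gra₁.spanOf fun l =>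
      IsIsolated l (Sum.inr x) ∧ ∀ v : A ⊕ Fin (k + 1), v.isRight = true → v ≠ Sum.inr x →
        IsSaturated l v ∧ IsAnchored (fun v => v.isRight = true) l v := by
  refine monomialSpan_mono ?_ (relabel_mem_spanOf (Sum.map id x.succAbove) hΓ)
  rintro l' - ⟨l, hl, hR⟩
  constructor
  · intro e' he'
    obtain ⟨e, -, hs, ht⟩ := exists_right_of_forall₂ hR.flip he'
    rw [hs, ht]
    constructor <;> intro h <;> obtain ⟨u, -, hu⟩ := Option.map_eq_some_iff.1 h <;>
      exact succAbove_map_ne x u hu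
  · rintro (a | y) hy hyx
    · simp at hy
    · obtain ⟨i, rfl⟩ := Fin.exists_succAbove_eq fun h => hyx (congrArg Sum.inr h)
      obtain ⟨hsat, hanch⟩ := hl (Sum.inr i) rfl
      refine ⟨hsat.of_forall₂ (fun e e' h => ⟨fun hs => ?_, fun ht => ?_⟩) hR,
        hanch.map (φ := Sum.map id x.succAbove) ?_ fun e he u v hu hv => ?_⟩
      · rw [h.1, hs]; rfl
      · rw [h.2, ht]; rfl
      · rintro (a | j) <;> simp
      · obtain ⟨e', he', hs, ht⟩ := exists_right_of_forall₂ hR he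
        exact ⟨e', he', by rw [hs, hu]; rfl, by rw [ht, hv]; rfl⟩

/-- The internal vertex `y` is saturated in the differential of an invariant combination of good
graphs.  Splitting an internal vertex `x` into `x` and the new vertex `y` or, with the roles
exchanged, splitting `y` into `y` and the new vertex `x` gives the same result by invariance, so
that together the coefficients `1 / 2` amount to the coefficient `1`. -/
theorem sum_newVertex_mem_saturatedSpan [Fintype A]
    (hinv : ∀ σ : Equiv.Perm (Fin k), Gra₁.relabel (Sum.map id σ) Γ = Γ)
    (hΓ : Γ ∈ Gra₁.spanOf fun l => IsGood (fun v => v.isRight = true) l) (y : Fin (k + 1)) :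
    ∑ x : Fin (k + 1), newVertex splitCoeff (Sum.inr x)
      (Gra₁.relabel (Sum.map id x.succAbove) Γ) ∈ saturatedSpan (Sum.inr y) := by
  classical
  have hswap : ∀ x : Fin (k + 1), Gra₁.relabel (Sum.map id y.succAbove) Γ =
      Gra₁.relabel (Equiv.swap (Sum.inr x) (Sum.inr y) ∘ Sum.map id x.succAbove) Γ := by
    intro x
    have hcomp : (Equiv.swap (Sum.inr x) (Sum.inr y) ∘ Sum.map id x.succAbove :
        A ⊕ Fin k → A ⊕ Fin (k + 1)) = Sum.map id (Equiv.swap x y) ∘ Sum.map id x.succAbove := by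
      ext (a | i)
      · simp [Equiv.swap_apply_of_ne_of_ne]
      · simp [Sum.inr_injective.swap_apply]
    rw [hcomp, ← relabel_relabel, relabel_relabel_succAbove hinv, Equiv.swap_apply_left]
  refine sum_mem_of_add_mem (newVertex_one_mem_saturatedSpan
    (monomialSpan_mono (fun _ _ h => h.1) (relabel_succAbove_mem y hΓ)))
    (newVertex_eq_one_add y _) (by simp) fun x hxy => ?_
  rw [hswap x, ← cut_relabel_swap (succAbove_map_injective x) (succAbove_map_ne x),
    add_comm (edge _ _) (edge _ _)]
  exact newVertex_add_mem_saturatedSpan splitCoeff (monomialSpan_mono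
    (fun _ _ h => (h.2 (Sum.inr y) rfl fun h' => hxy (Sum.inr_injective h').symm).1)
    (relabel_succAbove_mem x hΓ))

theorem sum_newVertex_mem [Fintype A] {c : Prop} {n : ℤ}
    (hinv : ∀ σ : Equiv.Perm (Fin k), Gra₁.relabel (Sum.map id σ) Γ = Γ)
    (hΓ : Γ ∈ Gra₁.spanOf fun l =>
      (l.length : ℤ) = n ∧ (c → IsGood (fun v => v.isRight = true) l)) :
    ∑ x : Fin (k + 1), newVertex splitCoeff (Sum.inr x)
      (Gra₁.relabel (Sum.map id x.succAbove) Γ) ∈ Gra₁.spanOf fun l =>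
        (l.length : ℤ) = n + 1 ∧ (c → IsGood (fun v => v.isRight = true) l) := by
  have hlen : ∑ x : Fin (k + 1), newVertex splitCoeff (Sum.inr x)
      (Gra₁.relabel (Sum.map id x.succAbove) Γ) ∈
        Gra₁.spanOf fun l => (l.length : ℤ) = n + 1 :=
    sum_mem fun x _ => newVertex_mem_length (monomialSpan_mono
      (fun _ _ ⟨_, hP, hR⟩ => hR.length_eq ▸ hP.1) (relabel_mem_spanOf _ hΓ))
  by_cases hc : c
  · have hΓ' : Γ ∈ Gra₁.spanOf fun l => IsGood (fun v => v.isRight = true) l :=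
      monomialSpan_mono (fun _ _ h => h.2 hc) hΓ
    have hanch : ∑ x : Fin (k + 1), newVertex splitCoeff (Sum.inr x)
        (Gra₁.relabel (Sum.map id x.succAbove) Γ) ∈
          Gra₁.spanOf fun l => (∀ y : Fin (k + 1), IsSaturated l (Sum.inr y)) →
            ∀ v, IsAnchored (fun v => v.isRight = true) l v :=
      sum_mem fun x _ => monomialSpan_mono (fun _ _ h hs => h (hs x)) (newVertex_mem_anchored
        (monomialSpan_mono (fun _ _ h => ⟨h.1, fun v hv hvx => (h.2 v hv hvx).2⟩)
          (relabel_succAbove_mem x hΓ')))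
    -- All three conditions depend only on the set of edges, so that they can be combined.
    have hsat := mem_monomialSpan_forall (fun y _ _ hperm h => h.perm hperm)
      (sum_newVertex_mem_saturatedSpan hinv hΓ')
    have hall := mem_monomialSpan_and (fun _ _ hperm h y => (h y).perm hperm)
      (fun _ _ hperm h hs v => (h (fun y => (hs y).perm hperm.symm) v).perm hperm) hsat hanch
    have hall' := mem_monomialSpan_and
      (fun _ _ hperm h => ⟨fun y => (h.1 y).perm hperm,
        fun hs v => (h.2 (fun y => (hs y).perm hperm.symm) v).perm hperm⟩)
      (fun _ _ hperm h => hperm.length_eq ▸ h) hall hlen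
    refine monomialSpan_mono (fun l _ h => ⟨h.2, fun _ => ?_⟩) hall'
    rintro (a | y) hv
    · simp at hv
    · exact ⟨h.1.1 y, h.1.2 h.1.1 _⟩
  · exact monomialSpan_mono (fun l _ h => ⟨h, fun hc' => absurd hc' hc⟩) hlen

end TwDiff

/-! ### The operations on the twists -/

theorem mem_twSpan₁_iff {A : Type} {c : Prop} {d : ℤ} {f : PreTw₁ A} :
    f ∈ twSpan₁ A d (fun k l => c → IsGraphs₁Graph k l) ↔
      (∀ k (σ : Equiv.Perm (Fin k)), Gra₁.relabel (Sum.map id σ) (f k) = f k) ∧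
      ∀ k : ℕ, f k ∈ Gra₁.spanOf fun l => (l.length : ℤ) = 2 * (k : ℤ) - d ∧
        (c → IsGood (fun v => v.isRight = true) l) :=
  and_congr Iff.rfl (forall_congr' fun _ =>
    ⟨fun h => monomialSpan_mono
      (fun _ hl h => ⟨h.1, fun hc => (isGraphs₁Graph_iff hl).1 (h.2 hc)⟩) h,
    fun h => monomialSpan_mono
      (fun _ hl h => ⟨h.1, fun hc => (isGraphs₁Graph_iff hl).2 (h.2 hc)⟩) h⟩)

theorem mem_range_orderEmbOfFin_or {k : ℕ} (S : Finset (Fin k)) (i : Fin k) :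
    (∃ j, S.orderEmbOfFin rfl j = i) ∨ ∃ j, Sᶜ.orderEmbOfFin rfl j = i := by
  have h : ∀ T : Finset (Fin k), (∃ j, T.orderEmbOfFin rfl j = i) ↔ i ∈ T := fun T => by
    rw [← Set.mem_range, Finset.range_orderEmbOfFin, Finset.mem_coe]
  rw [h, h, Finset.mem_compl]
  exact em _

theorem isSubMoperad_twSpan (c : Prop) :
    IsSubMoperad (fun B d => twSpan B d fun k l => c → IsGraphsGraph k l)
      (fun A d => twSpan₁ A d fun k l => c → IsGraphs₁Graph k l) where
  unit_mem := by
    rw [mem_twSpan₁_iff]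
    refine ⟨fun k σ => ?_, fun k => ?_⟩
    · simp only [twUnit]; split_ifs <;> simp
    · simp only [twUnit]
      split_ifs with hk
      · subst hk
        refine one_mem_monomialSpan ⟨by simp, fun _ => ?_⟩
        rintro (a | i)
        · exact a.elim
        · exact i.elim0
      · exact zero_mem _
  relabel_mem := by
    intro A A' _ φ d f hf
    rw [mem_twSpan₁_iff] at hf ⊢
    refine ⟨fun k σ => ?_, fun k => relabel_mem ?_ ?_ (hf.2 k)⟩
    · conv_rhs => rw [twRelabel, ← hf.1 k σ]
      rw [twRelabel, relabel_relabel, relabel_relabel]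
      simp only [Sum.map_comp_map, Function.id_comp, Function.comp_id]
    · rintro (a | i) hw
      · simp at hw
      · exact ⟨Sum.inr i, rfl, rfl⟩
    · rintro (a | i) <;> simp
  diff_mem := by
    intro A _ _ d f hf
    rw [mem_twSpan₁_iff] at hf ⊢
    refine ⟨relabel_twDiff hf.1, fun k => ?_⟩
    cases k with
    | zero => exact zero_mem _
    | succ k =>
      rw [twDiff_succ]
      refine monomialSpan_mono (fun l _ h => ⟨?_, h.2⟩) (sum_newVertex_mem (hf.1 k) (hf.2 k))
      rw [h.1]; push_cast; ring
  insert_mem := by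
    intro A B _ _ _ a d e f g hf hg
    rw [mem_twSpan₁_iff] at hf ⊢
    have hg' : ∀ k : ℕ, g k ∈ Gra.spanOf fun l => (l.length : ℤ) = 2 * (k : ℤ) - e ∧
        (c → IsGoodUndirected (fun v => v.isRight = true) l) := fun k =>
      monomialSpan_mono (fun _ hl h => ⟨h.1, fun hc => (h.2 hc).isGoodUndirected hl⟩) (hg.2 k)
    refine ⟨relabel_twInsert a hf.1 hg.1, fun k => ?_⟩
    rw [twInsert_eq_sum]
    refine sum_mem fun S _ => ?_
    refine monomialSpan_mono (fun l _ h => ⟨?_, h.2⟩) (relabel_mem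
      (J := fun v => v.isRight = true) ?_ ?_ (insert_mem (v := Sum.inl a) (hf.2 S.card)
        (hg' Sᶜ.card)))
    · rintro (w | i) hw
      · simp at hw
      · rcases mem_range_orderEmbOfFin_or S i with ⟨j, rfl⟩ | ⟨j, rfl⟩
        · exact ⟨Sum.inl ⟨Sum.inr j, by simp⟩, rfl, rfl⟩
        · exact ⟨Sum.inr (Sum.inr j), rfl, rfl⟩
    · rintro (⟨x | i, _⟩ | (b | j)) <;> simp [insertPlace]
    · have := Finset.card_add_card_compl S
      rw [Fintype.card_fin] at this
      omega
  comp_mem := by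
    intro A B _ _ d e f g hf hg
    rw [mem_twSpan₁_iff] at hf hg ⊢
    refine ⟨relabel_twComp hf.1 hg.1, fun k => sum_mem fun S _ => ?_⟩
    refine monomialSpan_mono (fun l _ h => ⟨?_, h.2⟩) (relabel_mem
      (J := fun v => v.isRight = true) ?_ ?_ (comp_mem (hf.2 S.card) (hg.2 Sᶜ.card)))
    · rintro (w | i) hw
      · simp at hw
      · rcases mem_range_orderEmbOfFin_or S i with ⟨j, rfl⟩ | ⟨j, rfl⟩
        · exact ⟨Sum.inl (Sum.inr j), rfl, rfl⟩
        · exact ⟨Sum.inr (Sum.inr j), rfl, rfl⟩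
    · rintro ((a | i) | (b | j)) <;> simp
    · have := Finset.card_add_card_compl S
      rw [Fintype.card_fin] at this
      omega

theorem Graphs_le_fGraphs (B : Type) (d : ℤ) : Graphs B d ≤ fGraphs B d := fun _ hf =>
  ⟨hf.1, fun k => monomialSpan_mono (fun _ _ h => ⟨h.1, trivial⟩) (hf.2 k)⟩

theorem Graphs₁_le_fGraphs₁ (A : Type) (d : ℤ) : Graphs₁ A d ≤ fGraphs₁ A d := fun _ hf =>
  ⟨hf.1, fun k => monomialSpan_mono (fun _ _ h => ⟨h.1, trivial⟩) (hf.2 k)⟩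

end TwistedGraphs

end

theorem mainTheorem5 :
    TwistedGraphs.IsSubMoperad TwistedGraphs.fGraphs TwistedGraphs.fGraphs₁ ∧
      (∀ (B : Type) (d : ℤ), TwistedGraphs.Graphs B d ≤ TwistedGraphs.fGraphs B d) ∧
      (∀ (A : Type) (d : ℤ), TwistedGraphs.Graphs₁ A d ≤ TwistedGraphs.fGraphs₁ A d) ∧
      TwistedGraphs.IsSubMoperad TwistedGraphs.Graphs TwistedGraphs.Graphs₁ := by
  refine ⟨?_, TwistedGraphs.Graphs_le_fGraphs, TwistedGraphs.Graphs₁_le_fGraphs₁, ?_⟩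
  · have := TwistedGraphs.isSubMoperad_twSpan False
    simp only [false_imp_iff] at this
    exact this
  · have := TwistedGraphs.isSubMoperad_twSpan True
    simp only [true_imp_iff] at this
    exact this
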